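/- Let $\Bbbk\in\{\mathbb R,\mathbb C\}$, let $m,n\ge 0$ be integers, let $\pi\subset\{1,\dots,m\}$ and $k=\sharp\pi$. For $A\in\Bbbk^{m\times n}$ let $\sigma_1\ge\sigma_2\ge\cdots$ be its singular values, with $\sigma_i=0$ for $i>\operatorname{rank}A$, let $A=U\Sigma V^H$ be a full singular value decomposition (SVD) with the singular values in decreasing order on the diagonal of $\Sigma$, and let $\mathrm U_\pi$ be the span of the columns of $U$ at the positions in $\pi$. A left singular subspace of $A$ is a sum of eigenspaces of $AA^H$ for eigenvalues $\sigma^2$, where $\sigma$ runs through a set of singular values of $A$ ($0$ is allowed). Let $$\mathcal U_\pi=\{A\in\Bbbk^{m\times n}\mid \mathrm U_\pi\text{ is a left singular subspace of }A\};$$ for $A\in\mathcal U_\pi$ the space $\mathrm U_\pi$ does not depend on the chosen SVD. Let $\mathcal L_\pi^\Bbbk:\mathcal U_\pi\to\mathrm{Gr}(k,\Bbbk^m)$, $A\mapsto\mathrm U_\pi$, where the Grassmannian $\mathrm{Gr}(k,\Bbbk^m)$ is realized as the set of projectors $QQ^H$ with $Q\in\Bbbk^{m\times k}$, $Q^HQ=I_k$.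 Equip matrices with the Frobenius distance $d(A,A')=\|A-A'\|_F$, and $\mathrm{Gr}(k,\Bbbk^m)$ with any one of the chordal distance $\|\sin\boldsymbol\theta\|$, the Grassmann distance $\|\boldsymbol\theta\|$ and the Procrustes distance $\|2\sin(\boldsymbol\theta/2)\|$, where $\boldsymbol\theta$ is the vector of principal angles $\theta_i=\arccos\sigma_i(Q^HQ')$, $i=1,\dots,k$, between $QQ^H$ and $Q'Q'^H$. Let $$\kappa[\mathcal L_\pi^\Bbbk](A)=\lim_{\epsilon\to0}\ \sup_{\substack{A'\in\mathcal U_\pi,\ A'\ne A\\ \|A-A'\|_F\le\epsilon}}\frac{d_{\mathrm{Gr}}(\mathcal L_\pi^\Bbbk(A),\mathcal L_\pi^\Bbbk(A'))}{\|A-A'\|_F}\quad(A\in\mathcal U_\pi)$$ be Rice's condition number (a supremum over the empty set is $0$), and let $\kappa_\pi^\Bbbk(A)=\kappa[\mathcal L_\pi^\Bbbk](A)$ for $A\in\mathcal U_\pi$ and $\kappa_\pi^\Bbbk(A)=\infty$ for $A\notin\mathcal U_\pi$. Then: 1. The map $\kappa_\pi^\Bbbk:\Bbbk^{m\times n}\to[0,\infty]\subset\mathbb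 R\cup\{\infty\}$ is continuous. 2. $\lim_{A\to\partial\mathcal U_\pi}\kappa[\mathcal L_\pi^\Bbbk](A)=\infty$, where $\partial\mathcal U_\pi$ is the boundary of $\mathcal U_\pi$: for every $M\ge 0$ there is $\delta>0$ such that $\kappa[\mathcal L_\pi^\Bbbk](A)>M$ for all $A\in\mathcal U_\pi$ for which there is a $B\in\partial\mathcal U_\pi$ with $\|A-B\|_F<\delta$. 3. If $\pi$ contains either all or none of the indices $i\in\{1,\dots,m\}$ with $i>n$ (an empty condition when $m\le n+1$), then $\mathcal U_\pi\cup\partial\mathcal U_\pi=\Bbbk^{m\times n}$. -/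

import Mathlib

open scoped Matrix ENNReal NNReal

noncomputable section

/-! ### Rice's condition number -/

/-- The supremum of the difference quotients `d_Y (f x) (f x') / d_X x x'` over all `x' ≠ x` with
`d_X x x' ≤ ε` (it is `0` if there are none). -/
def riceQuotientSup {X Y : Type*} (dX : X → X → ℝ) (dY : Y → Y → ℝ) (f : X → Y) (x : X)
    (ε : ℝ) : ℝ≥0∞ :=
  ⨆ (x' : X) (_ : x' ≠ x) (_ : dX x x' ≤ ε), ENNReal.ofReal (dY (f x) (f x') / dX x x')

/-- Rice's condition number of `f : X → Y` at `x`, with respect to the distances `dX` and `dY`: the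
limit of `riceQuotientSup dX dY f x ε` as `ε` decreases to `0`. The supremum is monotone in `ε`, so
the limit is an infimum; see `tendsto_riceQuotientSup`. -/
def riceCond {X Y : Type*} (dX : X → X → ℝ) (dY : Y → Y → ℝ) (f : X → Y) (x : X) : ℝ≥0∞ :=
  ⨅ (ε : ℝ) (_ : 0 < ε), riceQuotientSup dX dY f x ε

theorem tendsto_riceQuotientSup {X Y : Type*} (dX : X → X → ℝ) (dY : Y → Y → ℝ) (f : X → Y)
    (x : X) :
    Filter.Tendsto (riceQuotientSup dX dY f x) (nhdsWithin 0 (Set.Ioi 0))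
      (nhds (riceCond dX dY f x)) := by
  have hmono : Monotone (riceQuotientSup dX dY f x) := by
    intro a b hab
    refine iSup_mono fun x' => iSup_mono fun _ => ?_
    exact iSup_le fun h => le_iSup_of_le (h.trans hab) le_rfl
  have h := hmono.tendsto_nhdsGT (0 : ℝ)
  rwa [sInf_image] at h

/-! ### Singular values, singular value decompositions, singular subspaces -/

section SVD

variable {𝕜 : Type*} [RCLike 𝕜] {m n : ℕ}

/-- The `i`-th largest singular value of `A`, indexed from `0`, and `0` from index `rank A` on. -/
def singVal (A : Matrix (Fin m) (Fin n) 𝕜) (i : ℕ) : ℝ :=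
  (Matrix.toEuclideanLin A).singularValues i

/-- The `m × n` matrix with the singular values of `A`, in decreasing order, on its diagonal. -/
def singValMatrix (A : Matrix (Fin m) (Fin n) 𝕜) : Matrix (Fin m) (Fin n) 𝕜 :=
  Matrix.of fun i j => if (i : ℕ) = (j : ℕ) then ((singVal A i : ℝ) : 𝕜) else 0

/-- `A = U * Σ * Vᴴ` is a full singular value decomposition of `A`. -/
def IsFullSVD (A : Matrix (Fin m) (Fin n) 𝕜) (U : Matrix (Fin m) (Fin m) 𝕜)
    (V : Matrix (Fin n) (Fin n) 𝕜) : Prop :=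
  U ∈ Matrix.unitaryGroup (Fin m) 𝕜 ∧ V ∈ Matrix.unitaryGroup (Fin n) 𝕜 ∧
    A = U * singValMatrix A * Vᴴ

/-- The left singular subspace of `A` associated with a set `S` of singular values: the sum of the
eigenspaces of `A * Aᴴ` for the eigenvalues `s ^ 2`, `s ∈ S`. -/
def leftSingularSubspace (A : Matrix (Fin m) (Fin n) 𝕜) (S : Set ℝ) :
    Submodule 𝕜 (Fin m → 𝕜) :=
  ⨆ s ∈ S, Module.End.eigenspace (Matrix.toLin' (A * Aᴴ)) (((s ^ 2 : ℝ)) : 𝕜)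

/-- `W` is a left singular subspace of `A`: it is the one associated with some set `S` of singular
values of `A`, where `0` is always allowed (it lies in the range of the zero-padded `singVal A`). -/
def IsLeftSingularSubspace (A : Matrix (Fin m) (Fin n) 𝕜) (W : Submodule 𝕜 (Fin m → 𝕜)) : Prop :=
  ∃ S : Set ℝ, S ⊆ Set.range (singVal A) ∧ W = leftSingularSubspace A S

/-- The span of the columns of `U` at the positions in `π`. -/
def columnSpan (U : Matrix (Fin m) (Fin m) 𝕜) (π : Finset (Fin m)) : Submodule 𝕜 (Fin m → 𝕜) :=
  Submodule.span 𝕜 (U.col '' (π : Set (Fin m)))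

/-- The set `𝒰_π` of the matrices `A` for which the span `U_π` of the left singular vectors at the
positions in `π` is a left singular subspace of `A`. The choice of the singular value decomposition
does not matter; see `columnSpan_eq_of_isFullSVD`. -/
def goodSet (𝕜 : Type*) [RCLike 𝕜] (m n : ℕ) (π : Finset (Fin m)) :
    Set (Matrix (Fin m) (Fin n) 𝕜) :=
  {A | ∃ (U : Matrix (Fin m) (Fin m) 𝕜) (V : Matrix (Fin n) (Fin n) 𝕜),
    IsFullSVD A U V ∧ IsLeftSingularSubspace A (columnSpan U π)}

end SVD

section WellDefined

variable {𝕜 : Type*} [RCLike 𝕜] {m n : ℕ}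

theorem singVal_nonneg (A : Matrix (Fin m) (Fin n) 𝕜) (i : ℕ) : 0 ≤ singVal A i :=
  LinearMap.singularValues_nonneg _ i

theorem singVal_of_le (A : Matrix (Fin m) (Fin n) 𝕜) {i : ℕ} (hi : n ≤ i) : singVal A i = 0 :=
  LinearMap.singularValues_of_finrank_le _ (by simpa using hi)

theorem singVal_congr {m' d : ℕ} {M : Matrix (Fin m) (Fin d) 𝕜} {N : Matrix (Fin m') (Fin d) 𝕜}
    (h : (Mᴴ * M).charpoly = (Nᴴ * N).charpoly) : singVal M = singVal N := by
  have key : ∀ {k : ℕ} (K : Matrix (Fin k) (Fin d) 𝕜),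
      (LinearMap.adjoint (Matrix.toEuclideanLin K) ∘ₗ Matrix.toEuclideanLin K).charpoly
        = (Kᴴ * K).charpoly := by
    intro k K
    rw [← Matrix.toEuclideanLin_conjTranspose_eq_adjoint, Matrix.toEuclideanLin_eq_toLin_orthonormal,
      Matrix.toEuclideanLin_eq_toLin_orthonormal, ← Matrix.toLin_mul, Matrix.charpoly_toLin]
  have hfin : Module.finrank 𝕜 (EuclideanSpace 𝕜 (Fin d)) = d := by simp
  have he := (LinearMap.IsSymmetric.eigenvalues_eq_eigenvalues_iff
    (Matrix.toEuclideanLin M).isSymmetric_adjoint_comp_self hfin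
    (Matrix.toEuclideanLin N).isSymmetric_adjoint_comp_self hfin).2 (by rw [key, key, h])
  funext i
  rcases lt_or_ge i d with hi | hi
  · unfold singVal
    rw [LinearMap.singularValues_of_lt _ hfin hi, LinearMap.singularValues_of_lt _ hfin hi, he]
  · rw [singVal_of_le _ hi, singVal_of_le _ hi]

theorem IsFullSVD.mul_col {A : Matrix (Fin m) (Fin n) 𝕜} {U : Matrix (Fin m) (Fin m) 𝕜}
    {V : Matrix (Fin n) (Fin n) 𝕜} (h : IsFullSVD A U V) :
    A * Aᴴ = U * Matrix.diagonal (fun i : Fin m => ((singVal A i ^ 2 : ℝ) : 𝕜)) * Uᴴ := by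
  obtain ⟨hU, hV, hA⟩ := h
  have hV' : Vᴴ * V = 1 := (Matrix.mem_unitaryGroup_iff').1 hV
  have hS : singValMatrix A * (singValMatrix A)ᴴ
      = Matrix.diagonal (fun i : Fin m => ((singVal A i ^ 2 : ℝ) : 𝕜)) := by
    ext i j
    rw [Matrix.mul_apply, Matrix.diagonal_apply]
    simp only [singValMatrix, Matrix.of_apply, Matrix.conjTranspose_apply]
    by_cases hi : (i : ℕ) < n
    · rw [Finset.sum_eq_single (⟨i, hi⟩ : Fin n)]
      · by_cases hij : i = j
        · subst hij
          simp [pow_two]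
        · have : ¬ ((j : ℕ) = (i : ℕ)) := fun h => hij (Fin.ext h.symm)
          simp [hij, this]
      · intro b _ hb
        have : ¬ ((i : ℕ) = (b : ℕ)) := fun h => hb (Fin.ext h.symm)
        simp [this]
      · simp
    · rw [singVal_of_le A (not_lt.1 hi)]
      simp
  calc A * Aᴴ = (U * singValMatrix A * Vᴴ) * (U * singValMatrix A * Vᴴ)ᴴ := by rw [← hA]
    _ = U * singValMatrix A * (Vᴴ * V) * (singValMatrix A)ᴴ * Uᴴ := by
        simp only [Matrix.conjTranspose_mul, Matrix.conjTranspose_conjTranspose, Matrix.mul_assoc]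
    _ = _ := by rw [hV', Matrix.mul_one, Matrix.mul_assoc U, hS]

/-- Membership in a column span, read off in the coordinates given by the unitary matrix. -/
theorem mem_columnSpan_iff {U : Matrix (Fin m) (Fin m) 𝕜} (hU : U ∈ Matrix.unitaryGroup (Fin m) 𝕜)
    (π : Finset (Fin m)) (x : Fin m → 𝕜) :
    x ∈ columnSpan U π ↔ ∀ i ∉ π, (Uᴴ *ᵥ x) i = 0 := by
  have h1 : Uᴴ * U = 1 := (Matrix.mem_unitaryGroup_iff').1 hU
  have h2 : U * Uᴴ = 1 := (Matrix.mem_unitaryGroup_iff).1 hU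
  constructor
  · intro hx i hi
    induction hx using Submodule.span_induction with
    | mem y hy =>
      obtain ⟨j, hj, rfl⟩ := hy
      have : (Uᴴ *ᵥ U.col j) i = (Uᴴ * U) i j := rfl
      rw [this, h1, Matrix.one_apply_ne]
      rintro rfl
      exact hi hj
    | zero => simp
    | add y z _ _ hy hz => rw [Matrix.mulVec_add, Pi.add_apply, hy, hz, add_zero]
    | smul c y _ hy => rw [Matrix.mulVec_smul, Pi.smul_apply, hy, smul_zero]
  · intro h
    have hx : x = ∑ i, (Uᴴ *ᵥ x) i • U.col i := by
      have : x = U *ᵥ (Uᴴ *ᵥ x) := by rw [Matrix.mulVec_mulVec, h2, Matrix.one_mulVec]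
      conv_lhs => rw [this]
      ext a
      simp [Matrix.mulVec, dotProduct, Finset.sum_apply, mul_comm]
    rw [hx]
    refine Submodule.sum_mem _ fun i _ => ?_
    by_cases hi : i ∈ π
    · exact Submodule.smul_mem _ _ (Submodule.subset_span ⟨i, hi, rfl⟩)
    · rw [h i hi, zero_smul]
      exact Submodule.zero_mem _

theorem columnSpan_injective {U : Matrix (Fin m) (Fin m) 𝕜}
    (hU : U ∈ Matrix.unitaryGroup (Fin m) 𝕜) {π ρ : Finset (Fin m)}
    (h : columnSpan U π ≤ columnSpan U ρ) : π ⊆ ρ := by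
  intro i hi
  by_contra hρ
  have h1 : Uᴴ * U = 1 := (Matrix.mem_unitaryGroup_iff').1 hU
  have hc := (mem_columnSpan_iff hU ρ _).1 (h (Submodule.subset_span ⟨i, hi, rfl⟩)) i hρ
  have h3 : (Uᴴ *ᵥ U.col i) i = (Uᴴ * U) i i := rfl
  rw [h3, h1, Matrix.one_apply_eq] at hc
  exact one_ne_zero hc

open Classical in
/-- A left singular subspace is spanned by the left singular vectors that correspond to its
singular values, for every full singular value decomposition. -/
theorem leftSingularSubspace_eq_columnSpan {A : Matrix (Fin m) (Fin n) 𝕜}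
    {U : Matrix (Fin m) (Fin m) 𝕜} {V : Matrix (Fin n) (Fin n) 𝕜} (h : IsFullSVD A U V)
    {S : Set ℝ} (hS : S ⊆ Set.range (singVal A)) :
    leftSingularSubspace A S = columnSpan U {i | singVal A i ∈ S} := by
  have h1 : Uᴴ * U = 1 := (Matrix.mem_unitaryGroup_iff').1 h.1
  have hUA : Uᴴ * (A * Aᴴ)
      = Matrix.diagonal (fun i : Fin m => ((singVal A i ^ 2 : ℝ) : 𝕜)) * Uᴴ := by
    rw [h.mul_col, ← Matrix.mul_assoc, ← Matrix.mul_assoc, h1, Matrix.one_mul]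
  have hAU : A * Aᴴ * U
      = U * Matrix.diagonal (fun i : Fin m => ((singVal A i ^ 2 : ℝ) : 𝕜)) := by
    rw [h.mul_col, Matrix.mul_assoc, h1, Matrix.mul_one]
  apply le_antisymm
  · refine iSup₂_le fun s hs x hx => ?_
    rw [Module.End.mem_eigenspace_iff, Matrix.toLin'_apply] at hx
    rw [mem_columnSpan_iff h.1]
    intro i hi
    have hi' : singVal A i ∉ S := by simpa using hi
    have e : (Uᴴ *ᵥ ((A * Aᴴ) *ᵥ x)) i = ((singVal A i ^ 2 : ℝ) : 𝕜) * (Uᴴ *ᵥ x) i := by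
      rw [Matrix.mulVec_mulVec, hUA, ← Matrix.mulVec_mulVec, Matrix.mulVec_diagonal]
    rw [hx, Matrix.mulVec_smul, Pi.smul_apply, smul_eq_mul] at e
    by_contra h0
    have e2 := mul_right_cancel₀ h0 e
    have e3 : s ^ 2 = singVal A i ^ 2 := by exact_mod_cast e2
    obtain ⟨l, hl⟩ := hS hs
    have hs0 : 0 ≤ s := hl ▸ singVal_nonneg A l
    have e4 : s = singVal A i := (sq_eq_sq₀ hs0 (singVal_nonneg A i)).1 e3
    exact hi' (e4 ▸ hs)
  · refine Submodule.span_le.2 ?_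
    rintro _ ⟨i, hi, rfl⟩
    have hi' : singVal A i ∈ S := by simpa using hi
    refine (le_iSup₂ (f := fun s (_ : s ∈ S) => Module.End.eigenspace (Matrix.toLin' (A * Aᴴ))
      (((s ^ 2 : ℝ)) : 𝕜)) (singVal A i) hi') ?_
    rw [Module.End.mem_eigenspace_iff, Matrix.toLin'_apply]
    ext a
    have e : ((A * Aᴴ) *ᵥ U.col i) a = (A * Aᴴ * U) a i := rfl
    rw [e, hAU, Matrix.mul_diagonal, Pi.smul_apply, smul_eq_mul, mul_comm]
    rfl

/-- If `U_π` is a left singular subspace for one full singular value decomposition, then it is the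
same subspace for every other one. -/
theorem columnSpan_eq_of_isFullSVD {A : Matrix (Fin m) (Fin n) 𝕜}
    {U U' : Matrix (Fin m) (Fin m) 𝕜} {V V' : Matrix (Fin n) (Fin n) 𝕜} {π : Finset (Fin m)}
    (h : IsFullSVD A U V) (h' : IsFullSVD A U' V')
    (hπ : IsLeftSingularSubspace A (columnSpan U π)) : columnSpan U' π = columnSpan U π := by
  classical
  obtain ⟨S, hS, hW⟩ := hπ
  have e := hW.trans (leftSingularSubspace_eq_columnSpan h hS)
  have hπ : π = Finset.univ.filter (fun i : Fin m => singVal A i ∈ S) :=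
    (columnSpan_injective h.1 e.le).antisymm (columnSpan_injective h.1 e.ge)
  rw [hW, leftSingularSubspace_eq_columnSpan h' hS, ← hπ]

end WellDefined

/-! ### The Grassmannian and its distances -/

/-- The Grassmannian `Gr(d, 𝕜^p)` of `d`-dimensional subspaces of `𝕜^p`, realized as the set of
orthogonal projectors `Q * Qᴴ` with `Q` a `p × d` matrix with orthonormal columns. -/
def Gr (𝕜 : Type*) [RCLike 𝕜] (d p : ℕ) : Type _ :=
  {P : Matrix (Fin p) (Fin p) 𝕜 //
    ∃ Q : Matrix (Fin p) (Fin d) 𝕜, Qᴴ * Q = 1 ∧ P = Q * Qᴴ}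

section Grassmannian

variable {𝕜 : Type*} [RCLike 𝕜] {d p : ℕ}

/-- A matrix with orthonormal columns that represents the point `P` of the Grassmannian. -/
def Gr.basisMatrix (P : Gr 𝕜 d p) : Matrix (Fin p) (Fin d) 𝕜 := P.2.choose

/-- The vector of principal angles `θ_i = arccos (σ_i (Qᴴ * Q'))` between `P = Q * Qᴴ` and
`P' = Q' * Q'ᴴ`. It does not depend on the choice of `Q` and `Q'`; see `principalAngles_eq`. -/
def principalAngles (P P' : Gr 𝕜 d p) : Fin d → ℝ :=
  fun i => Real.arccos (singVal (P.basisMatrixᴴ * P'.basisMatrix) i)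

/-- The principal angles can be computed from any matrices with orthonormal columns that represent
the two points. -/
theorem principalAngles_eq (P P' : Gr 𝕜 d p) {Q Q' : Matrix (Fin p) (Fin d) 𝕜}
    (hQ : P.1 = Q * Qᴴ) (hQ1' : Q'ᴴ * Q' = 1) (hQ' : P'.1 = Q' * Q'ᴴ) :
    principalAngles P P' = fun i : Fin d => Real.arccos (singVal (Qᴴ * Q') i) := by
  obtain ⟨-, hR⟩ := P.2.choose_spec
  obtain ⟨hR1', hR'⟩ := P'.2.choose_spec
  change P.1 = P.basisMatrix * P.basisMatrixᴴ at hR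
  change P'.basisMatrixᴴ * P'.basisMatrix = 1 at hR1'
  change P'.1 = P'.basisMatrix * P'.basisMatrixᴴ at hR'
  unfold principalAngles
  generalize P.basisMatrix = R at *
  generalize P'.basisMatrix = R' at *
  have hproj : Q' * Q'ᴴ = R' * R'ᴴ := hQ'.symm.trans hR'
  have key : singVal (Rᴴ * R') = singVal (Qᴴ * Q') := by
    apply singVal_congr
    have e1 : (Rᴴ * R')ᴴ * (Rᴴ * R') = R'ᴴ * (P.1 * R') := by
      rw [hR]
      simp [Matrix.mul_assoc]
    have e2 : (Qᴴ * Q')ᴴ * (Qᴴ * Q') = Q'ᴴ * (P.1 * Q') := by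
      rw [hQ]
      simp [Matrix.mul_assoc]
    have e3 : Q'ᴴ * (P.1 * Q') = (Q'ᴴ * R') * (R'ᴴ * P.1 * Q') := by
      have : Q'ᴴ = Q'ᴴ * R' * R'ᴴ := by
        rw [Matrix.mul_assoc, ← hproj, ← Matrix.mul_assoc, hQ1', Matrix.one_mul]
      conv_lhs => rw [this]
      simp only [Matrix.mul_assoc]
    have e4 : (R'ᴴ * P.1 * Q') * (Q'ᴴ * R') = R'ᴴ * (P.1 * R') := by
      have : R' = Q' * Q'ᴴ * R' := by rw [hproj, Matrix.mul_assoc, hR1', Matrix.mul_one]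
      calc (R'ᴴ * P.1 * Q') * (Q'ᴴ * R') = R'ᴴ * (P.1 * (Q' * Q'ᴴ * R')) := by
            simp only [Matrix.mul_assoc]
        _ = R'ᴴ * (P.1 * R') := by rw [← this]
    rw [e1, e2, e3, Matrix.charpoly_mul_comm, e4]
  rw [key]

/-- The three distances on the Grassmannian. -/
inductive GrDistance
  | chordal
  | grassmann
  | procrustes

/-- The chordal distance `‖sin θ‖`, the Grassmann distance `‖θ‖` and the Procrustes distance
`‖2 sin (θ / 2)‖`, where `θ` is the vector of principal angles. -/
def grDist : GrDistance → Gr 𝕜 d p → Gr 𝕜 d p → ℝ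
  | .chordal, P, P' => √(∑ i, Real.sin (principalAngles P P' i) ^ 2)
  | .grassmann, P, P' => √(∑ i, principalAngles P P' i ^ 2)
  | .procrustes, P, P' => √(∑ i, (2 * Real.sin (principalAngles P P' i / 2)) ^ 2)

end Grassmannian

/-! ### The condition number of a left singular subspace -/

section Condition

variable {𝕜 : Type*} [RCLike 𝕜] {m n : ℕ}

/-- The Euclidean (Frobenius) distance of two matrices. -/
def frobDist (A A' : Matrix (Fin m) (Fin n) 𝕜) : ℝ :=
  √(∑ i, ∑ j, ‖A i j - A' i j‖ ^ 2)

/-- The columns of `U` at the positions in `π`, in increasing order, as a matrix. -/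
def selectColumns (U : Matrix (Fin m) (Fin m) 𝕜) (π : Finset (Fin m)) :
    Matrix (Fin m) (Fin π.card) 𝕜 :=
  U.submatrix id (π.orderEmbOfFin rfl)

theorem selectColumns_orthonormal {U : Matrix (Fin m) (Fin m) 𝕜}
    (hU : U ∈ Matrix.unitaryGroup (Fin m) 𝕜) (π : Finset (Fin m)) :
    (selectColumns U π)ᴴ * selectColumns U π = 1 := by
  have h : Uᴴ * U = 1 := (Matrix.mem_unitaryGroup_iff').1 hU
  have h2 : (selectColumns U π)ᴴ * selectColumns U π =
      (Uᴴ * U).submatrix (π.orderEmbOfFin rfl) (π.orderEmbOfFin rfl) := by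
    ext i j
    simp [selectColumns, Matrix.mul_apply]
  rw [h2, h, Matrix.submatrix_one _ (π.orderEmbOfFin rfl).injective]

/-- The map `𝒰_π → Gr(#π, 𝕜^m)` that takes `A` to the projector on the span of the left singular
vectors of `A` at the positions in `π`. Every full singular value decomposition of `A` gives the same
projector; see `leftMap_eq`. -/
def leftMap (π : Finset (Fin m)) (A : goodSet 𝕜 m n π) : Gr 𝕜 π.card m :=
  ⟨selectColumns A.2.choose π * (selectColumns A.2.choose π)ᴴ, selectColumns A.2.choose π,
    selectColumns_orthonormal A.2.choose_spec.choose_spec.1.1 π, rfl⟩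

/-- Every full singular value decomposition of `A ∈ 𝒰_π` can be used to compute `leftMap π A`. -/
theorem leftMap_eq (π : Finset (Fin m)) (A : goodSet 𝕜 m n π) {U : Matrix (Fin m) (Fin m) 𝕜}
    {V : Matrix (Fin n) (Fin n) 𝕜} (h : IsFullSVD A.1 U V) :
    (leftMap π A).1 = selectColumns U π * (selectColumns U π)ᴴ := by
  have key : ∀ {U₁ U₂ : Matrix (Fin m) (Fin m) 𝕜}, U₁ ∈ Matrix.unitaryGroup (Fin m) 𝕜 →
      columnSpan U₂ π ≤ columnSpan U₁ π →
      (selectColumns U₁ π * (selectColumns U₁ π)ᴴ) * (selectColumns U₂ π * (selectColumns U₂ π)ᴴ)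
        = selectColumns U₂ π * (selectColumns U₂ π)ᴴ := by
    intro U₁ U₂ h₁ hle
    rw [← Matrix.mul_assoc]
    congr 1
    ext a j
    have hx : U₂.col (π.orderEmbOfFin rfl j) ∈ columnSpan U₁ π :=
      hle (Submodule.subset_span ⟨_, Finset.orderEmbOfFin_mem π rfl j, rfl⟩)
    have hfix : ∀ x ∈ columnSpan U₁ π,
        (selectColumns U₁ π * (selectColumns U₁ π)ᴴ) *ᵥ x = x := by
      intro x hx
      induction hx using Submodule.span_induction with
      | mem y hy =>
        obtain ⟨i, hi, rfl⟩ := hy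
        have hr : i ∈ Set.range (π.orderEmbOfFin rfl) := by
          rw [Finset.range_orderEmbOfFin]
          exact hi
        obtain ⟨l, rfl⟩ := hr
        ext b
        have e : ((selectColumns U₁ π * (selectColumns U₁ π)ᴴ) *ᵥ
            U₁.col (π.orderEmbOfFin rfl l)) b
            = (selectColumns U₁ π * (selectColumns U₁ π)ᴴ * selectColumns U₁ π) b l := rfl
        rw [e, Matrix.mul_assoc, selectColumns_orthonormal h₁, Matrix.mul_one]
        rfl
      | zero => simp
      | add y z _ _ hy hz => rw [Matrix.mulVec_add, hy, hz]
      | smul c y _ hy => rw [Matrix.mulVec_smul, hy]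
    exact congrFun (hfix _ hx) a
  have h₀ := A.2.choose_spec.choose_spec
  have hspan := columnSpan_eq_of_isFullSVD h₀.1 h h₀.2
  have k1 := key h₀.1.1 hspan.le
  have k2 := key h.1 hspan.ge
  have k3 := congrArg Matrix.conjTranspose k1
  rw [Matrix.conjTranspose_mul] at k3
  simp only [Matrix.conjTranspose_mul, Matrix.conjTranspose_conjTranspose] at k3
  exact k2.symm.trans k3

/-- Rice's condition number of `leftMap π : 𝒰_π → Gr(#π, 𝕜^m)` at `A ∈ 𝒰_π`. -/
def leftCond (D : GrDistance) (π : Finset (Fin m)) (A : goodSet 𝕜 m n π) : ℝ≥0∞ :=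
  riceCond (fun B C : goodSet 𝕜 m n π => frobDist B.1 C.1) (grDist D) (leftMap π) A

open Classical in
/-- The condition number on the whole matrix space: `∞` outside `𝒰_π`. -/
def kappa (D : GrDistance) (π : Finset (Fin m)) (A : Matrix (Fin m) (Fin n) 𝕜) : ℝ≥0∞ :=
  if hA : A ∈ goodSet 𝕜 m n π then leftCond D π ⟨A, hA⟩ else ⊤

end Condition

end

/-!
Write `σ₁ ≥ σ₂ ≥ …` for the singular values of `A`. The matrix `A` lies in `goodSet` exactly if
`σ_i ≠ σ_j` for all `i ∈ π` and `j ∉ π` (`mem_goodSet_iff`). The condition number has the closed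
form

`κ(A) = max_{i ∈ π, j ∉ π} √(σ_i² + σ_j²) / |σ_i² - σ_j²|`

(`leftCond_eq_reciprocalGap`), where the maximum is `∞` if `σ_i = σ_j` for one of the pairs, so that
the formula also holds outside `goodSet` (`kappa_eq_reciprocalGap`). The reciprocal
`|a² - b²| / √(a² + b²)` is continuous on the whole plane, with value `0` at the origin, and at most
`2 |a - b|` (`continuous_gapRatio`, `gapRatio_le`). Singular values are `1`-Lipschitz for the
Frobenius norm (`abs_singVal_sub_le`). These facts give the continuity of `κ` and its uniform
divergence at the boundary, where `σ_i = σ_j` for some pair. The density of `goodSet`, under the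
hypothesis on `π`, follows by separating the singular values on the diagonal of a
singular value decomposition (`closure_goodSet`).

The proof of the closed form first reduces the three distances to the chordal one,
`c = ‖(1 - P) * P'‖`: each distance `d` satisfies `c ≤ d` and `√(1 - c²) * d ≤ c`
(`chordal_le_grDist_and_le`).

* Upper bound (`chordal_le_of_gapRatio`). Let `A = U Σ Vᴴ`, `A' = U' Σ' V'ᴴ` and `E = A' - A`. The
  entries of `W = Uᴴ U'` satisfy the exact identity
  `W_ji (σ'_i² - σ_j²) = σ'_i (Uᴴ E V')_ji + σ_j (Vᴴ Eᴴ U')_ji`, where missing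
  columns of `V` and `V'` are read as zero (`IsFullSVD.exists_right`). Summation over `j ∉ π` and
  `i ∈ π` leads to `‖(1 - P) * E‖² + ‖P' * E‖²`, which is at most `‖E‖² (1 + c)²`. No continuity of the
  singular vectors themselves, which may fail for multiple singular values, is involved.
* Lower bound (`norm_entry_le_chordal_mul`, `exists_perturbation`). The projectors commute with
  `A * Aᴴ` and `A' * A'ᴴ`, so an off-diagonal entry of `A' * A'ᴴ - A * Aᴴ` bounds `c` from below.
  It is applied to `A' = A + t X A`, where `X` exchanges the left singular vectors `u_i` and `u_j`
  and annihilates the others.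
-/

section

open scoped Matrix.Norms.Frobenius

/-! ### The Frobenius norm -/

section Frobenius

variable {𝕜 : Type*} [RCLike 𝕜] {l m n : ℕ}

theorem frobenius_norm_sq (A : Matrix (Fin m) (Fin n) 𝕜) :
    ‖A‖ ^ 2 = ∑ i, ∑ j, ‖A i j‖ ^ 2 := by
  have h : 0 ≤ ∑ i, ∑ j, ‖A i j‖ ^ 2 := by positivity
  rw [Matrix.frobenius_norm_def, ← Real.sqrt_eq_rpow]
  simp only [Real.rpow_ofNat]
  rw [Real.sq_sqrt h]

theorem frobDist_eq_norm (A B : Matrix (Fin m) (Fin n) 𝕜) : frobDist A B = ‖A - B‖ := by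
  rw [frobDist, ← Real.sqrt_sq (norm_nonneg (A - B)), frobenius_norm_sq]
  rfl

theorem frobenius_norm_sq_eq_trace (A : Matrix (Fin m) (Fin n) 𝕜) :
    ((‖A‖ ^ 2 : ℝ) : 𝕜) = (Aᴴ * A).trace := by
  rw [frobenius_norm_sq, Finset.sum_comm]
  simp only [Matrix.trace, Matrix.diag_apply, Matrix.mul_apply, Matrix.conjTranspose_apply]
  push_cast
  refine Finset.sum_congr rfl fun i _ => Finset.sum_congr rfl fun j _ => ?_
  rw [← RCLike.conj_mul]
  rfl

theorem frobenius_norm_isometry_mul {Q : Matrix (Fin l) (Fin m) 𝕜} (hQ : Qᴴ * Q = 1)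
    (A : Matrix (Fin m) (Fin n) 𝕜) : ‖Q * A‖ = ‖A‖ := by
  have h : ((‖Q * A‖ ^ 2 : ℝ) : 𝕜) = ((‖A‖ ^ 2 : ℝ) : 𝕜) := by
    rw [frobenius_norm_sq_eq_trace, frobenius_norm_sq_eq_trace, Matrix.conjTranspose_mul,
      Matrix.mul_assoc, ← Matrix.mul_assoc Qᴴ, hQ, Matrix.one_mul]
  exact (sq_eq_sq₀ (norm_nonneg _) (norm_nonneg _)).1 (RCLike.ofReal_injective h)

theorem frobenius_norm_mul_coisometry {Q : Matrix (Fin m) (Fin n) 𝕜} (hQ : Q * Qᴴ = 1)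
    (A : Matrix (Fin l) (Fin m) 𝕜) : ‖A * Q‖ = ‖A‖ := by
  rw [← Matrix.frobenius_norm_conjTranspose, Matrix.conjTranspose_mul,
    frobenius_norm_isometry_mul (by simpa using hQ), Matrix.frobenius_norm_conjTranspose]

theorem norm_entry_le_frobenius (A : Matrix (Fin m) (Fin n) 𝕜) (i : Fin m) (j : Fin n) :
    ‖A i j‖ ≤ ‖A‖ := by
  refine abs_le_of_sq_le_sq' ?_ (norm_nonneg _) |>.2
  rw [frobenius_norm_sq]
  exact (Finset.single_le_sum (f := fun j => ‖A i j‖ ^ 2) (fun _ _ => by positivity)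
    (Finset.mem_univ j)).trans (Finset.single_le_sum (f := fun i => ∑ j, ‖A i j‖ ^ 2)
      (fun _ _ => by positivity) (Finset.mem_univ i))

/-- Neighbourhoods in the entrywise topology are described by the Frobenius distance. -/
theorem exists_frobDist_ball {p : Matrix (Fin m) (Fin n) 𝕜 → Prop} {A : Matrix (Fin m) (Fin n) 𝕜}
    (h : ∀ᶠ B in nhds A, p B) : ∃ ε : ℝ, 0 < ε ∧ ∀ B, frobDist A B ≤ ε → p B := by
  obtain ⟨ε, hε, H⟩ := Metric.eventually_nhds_iff.1 h
  refine ⟨ε / 2, by positivity, fun B hB => H ?_⟩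
  rw [dist_comm, dist_eq_norm, ← frobDist_eq_norm]
  linarith

theorem tendsto_frobDist (A : Matrix (Fin m) (Fin n) 𝕜) :
    Filter.Tendsto (frobDist A) (nhds A) (nhds 0) := by
  have h : Continuous (frobDist A) := by
    unfold frobDist
    fun_prop
  simpa [frobDist] using h.tendsto A

end Frobenius

/-! ### Existence of singular value decompositions -/

section SVDExistence

variable {𝕜 : Type*} [RCLike 𝕜] {m n : ℕ}

theorem singVal_antitone (A : Matrix (Fin m) (Fin n) 𝕜) : Antitone (singVal A) :=
  LinearMap.singularValues_antitone _

theorem singVal_eq_zero_of_le_row (A : Matrix (Fin m) (Fin n) 𝕜) {i : ℕ} (hi : m ≤ i) :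
    singVal A i = 0 := by
  refine (LinearMap.singularValues_eq_zero_iff_le_finrank_range _).2 ?_
  exact (Submodule.finrank_le _).trans (by simpa using hi)

/-- The matrix whose columns are the vectors of an orthonormal basis is unitary. -/
theorem basisColumns_mem_unitaryGroup (b : OrthonormalBasis (Fin n) 𝕜 (EuclideanSpace 𝕜 (Fin n))) :
    Matrix.of (fun a i => b i a) ∈ Matrix.unitaryGroup (Fin n) 𝕜 := by
  rw [Matrix.mem_unitaryGroup_iff']
  ext i j
  rw [Matrix.mul_apply, Matrix.one_apply]
  have h := (orthonormal_iff_ite.1 b.orthonormal) i j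
  rw [← h, PiLp.inner_apply]
  refine Finset.sum_congr rfl fun a _ => ?_
  simp [Matrix.star_apply, mul_comm]

theorem exists_isFullSVD (A : Matrix (Fin m) (Fin n) 𝕜) :
    ∃ (U : Matrix (Fin m) (Fin m) 𝕜) (V : Matrix (Fin n) (Fin n) 𝕜), IsFullSVD A U V := by
  classical
  set T := Matrix.toEuclideanLin A with hT
  have hfin : Module.finrank 𝕜 (EuclideanSpace 𝕜 (Fin n)) = n := by simp
  set b := T.isSymmetric_adjoint_comp_self.eigenvectorBasis hfin with hb
  have hinner : ∀ i j, inner 𝕜 (T (b i)) (T (b j))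
      = if i = j then ((singVal A j ^ 2 : ℝ) : 𝕜) else 0 := by
    intro i j
    rw [← LinearMap.adjoint_inner_right]
    have h := T.isSymmetric_adjoint_comp_self.apply_eigenvectorBasis hfin j
    rw [← LinearMap.sq_singularValues_fin, LinearMap.comp_apply] at h
    rw [hb, h, inner_smul_right, orthonormal_iff_ite.1 (OrthonormalBasis.orthonormal _) i j]
    simp only [mul_ite, mul_one, mul_zero]
    rfl
  -- the left singular vectors for the nonzero singular values, to be completed to a basis
  let w : Fin m → EuclideanSpace 𝕜 (Fin m) := fun i =>
    if h : (i : ℕ) < n then (((singVal A i)⁻¹ : ℝ) : 𝕜) • T (b ⟨i, h⟩) else 0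
  have hlt : ∀ i : Fin m, singVal A i ≠ 0 → (i : ℕ) < n := fun i hi => by
    by_contra h
    exact hi (singVal_of_le A (not_lt.1 h))
  have hw : Orthonormal 𝕜 ({i : Fin m | singVal A i ≠ 0}.domRestrict w) := by
    rw [orthonormal_iff_ite]
    rintro ⟨i, hi⟩ ⟨j, hj⟩
    have hi' := hlt i hi
    have hj' := hlt j hj
    simp only [Set.domRestrict_apply, w, dif_pos hi', dif_pos hj', inner_smul_left,
      inner_smul_right, hinner, Fin.mk.injEq, Subtype.mk.injEq, RCLike.conj_ofReal]
    by_cases hij : i = j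
    · subst hij
      simp only [if_true]
      have hi0 : singVal A i ≠ 0 := hi
      norm_cast
      field_simp
    · have : ¬ ((i : ℕ) = j) := fun h => hij (Fin.ext h)
      simp [hij, this]
  obtain ⟨u, hu⟩ := hw.exists_orthonormalBasis_extension_of_card_eq (by simp)
  have hUV : A * Matrix.of (fun a i => b i a)
      = Matrix.of (fun a i => u i a) * singValMatrix A := by
    ext a j
    have e1 : (A * Matrix.of (fun a i => b i a)) a j = T (b j) a := by
      simp [hT, Matrix.mul_apply, Matrix.mulVec, dotProduct]
    rw [e1, Matrix.mul_apply]
    simp only [singValMatrix, Matrix.of_apply, mul_ite, mul_zero]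
    have hz : singVal A j = 0 → T (b j) = 0 := fun h0 => by
      rw [← inner_self_eq_zero (𝕜 := 𝕜), hinner]
      simp [h0]
    by_cases hj : (j : ℕ) < m
    · rw [Finset.sum_eq_single ⟨j, hj⟩]
      · simp only [if_true]
        by_cases h0 : singVal A j = 0
        · simp [h0, hz h0]
        · rw [hu ⟨j, hj⟩ h0]
          simp only [w, j.2, dif_pos, PiLp.smul_apply, smul_eq_mul]
          have h0' : ((singVal A j : ℝ) : 𝕜) ≠ 0 := by exact_mod_cast h0
          push_cast
          field_simp
      · intro i _ hi
        rw [if_neg fun h => hi (Fin.ext h)]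
      · simp
    · rw [hz (singVal_eq_zero_of_le_row A (not_lt.1 hj)), Finset.sum_eq_zero]
      · rfl
      · intro i _
        rw [if_neg]
        have := i.2
        omega
  have hV := basisColumns_mem_unitaryGroup b
  refine ⟨_, _, basisColumns_mem_unitaryGroup u, hV, ?_⟩
  rw [← hUV, Matrix.mul_assoc]
  have := Matrix.mem_unitaryGroup_iff.1 hV
  rw [Matrix.star_eq_conjTranspose] at this
  rw [this, Matrix.mul_one]

end SVDExistence

/-! ### Perturbation of singular values -/

section Weyl

variable {𝕜 : Type*} [RCLike 𝕜] {l m n : ℕ}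

/-- The `m × n` matrix with `s 0, s 1, …` on its diagonal. -/
def rectDiagonal (𝕜 : Type*) [RCLike 𝕜] (m n : ℕ) (s : ℕ → ℝ) : Matrix (Fin m) (Fin n) 𝕜 :=
  Matrix.of fun i j => if (i : ℕ) = (j : ℕ) then ((s i : ℝ) : 𝕜) else 0

theorem norm_sq_rectDiagonal_mul {s : ℕ → ℝ} (hm : ∀ i, m ≤ i → s i = 0)
    (c : Matrix (Fin n) (Fin l) 𝕜) :
    ‖rectDiagonal 𝕜 m n s * c‖ ^ 2 = ∑ j : Fin n, s j ^ 2 * ∑ k, ‖c j k‖ ^ 2 := by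
  have hD : (rectDiagonal 𝕜 m n s)ᴴ * rectDiagonal 𝕜 m n s
      = Matrix.diagonal fun j : Fin n => ((s j ^ 2 : ℝ) : 𝕜) := by
    ext i j
    rw [Matrix.mul_apply, Matrix.diagonal_apply]
    simp only [rectDiagonal, Matrix.of_apply, Matrix.conjTranspose_apply]
    by_cases hi : (i : ℕ) < m
    · rw [Finset.sum_eq_single (⟨i, hi⟩ : Fin m)]
      · by_cases hij : i = j
        · subst hij
          simp [pow_two]
        · have : ¬ ((i : ℕ) = (j : ℕ)) := fun h => hij (Fin.ext h)
          simp [hij, this]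
      · intro b _ hb
        have : ¬ ((b : ℕ) = (i : ℕ)) := fun h => hb (Fin.ext h)
        simp [this]
      · simp
    · rw [hm i (not_lt.1 hi), Finset.sum_eq_zero]
      · simp
      · intro b _
        have : ¬ ((b : ℕ) = (i : ℕ)) := by
          have := b.2
          omega
        simp [this]
  have h : ((‖rectDiagonal 𝕜 m n s * c‖ ^ 2 : ℝ) : 𝕜)
      = ((∑ j : Fin n, s j ^ 2 * ∑ k, ‖c j k‖ ^ 2 : ℝ) : 𝕜) := by
    rw [frobenius_norm_sq_eq_trace, Matrix.conjTranspose_mul, Matrix.mul_assoc,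
      ← Matrix.mul_assoc _ _ c, hD, Matrix.trace_mul_comm, Matrix.mul_assoc]
    simp only [Matrix.trace, Matrix.diag_apply, Matrix.diagonal_mul]
    simp only [Matrix.mul_apply, Matrix.conjTranspose_apply]
    push_cast
    refine Finset.sum_congr rfl fun i _ => ?_
    congr 1
    refine Finset.sum_congr rfl fun k _ => ?_
    rw [← RCLike.mul_conj]
    rfl
  exact RCLike.ofReal_injective h

/-- One-sided Weyl inequality for matrices given by decompositions `U * Σ * Vᴴ` with decreasing
diagonals. Such a decomposition need not refer to `singVal`, so that the lemma also identifies
the singular values of a matrix given in this form. -/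
theorem diagonal_le_add_norm_sub {A B : Matrix (Fin m) (Fin n) 𝕜} {U U' : Matrix (Fin m) (Fin m) 𝕜}
    {V V' : Matrix (Fin n) (Fin n) 𝕜} {s s' : ℕ → ℝ}
    (hU : U ∈ Matrix.unitaryGroup (Fin m) 𝕜) (hU' : U' ∈ Matrix.unitaryGroup (Fin m) 𝕜)
    (hV : V ∈ Matrix.unitaryGroup (Fin n) 𝕜) (hV' : V' ∈ Matrix.unitaryGroup (Fin n) 𝕜)
    (hA : A = U * rectDiagonal 𝕜 m n s * Vᴴ) (hB : B = U' * rectDiagonal 𝕜 m n s' * V'ᴴ)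
    (hs : Antitone s) (hs' : Antitone s') (hs0 : ∀ i, 0 ≤ s i) (hs0' : ∀ i, 0 ≤ s' i)
    (hm : ∀ i, m ≤ i → s i = 0) (hm' : ∀ i, m ≤ i → s' i = 0) {i : ℕ} (hi : i < n) :
    s i ≤ s' i + ‖A - B‖ := by
  classical
  have hU1 : Uᴴ * U = 1 := Matrix.mem_unitaryGroup_iff'.1 hU
  have hU1' : U'ᴴ * U' = 1 := Matrix.mem_unitaryGroup_iff'.1 hU'
  have hV1 : Vᴴ * V = 1 := Matrix.mem_unitaryGroup_iff'.1 hV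
  have hV1' : V'ᴴ * V' = 1 := Matrix.mem_unitaryGroup_iff'.1 hV'
  have hV2' : V' * V'ᴴ = 1 := Matrix.mem_unitaryGroup_iff.1 hV'
  -- A common vector of the span of the first `i + 1` columns of `V` and of the span of the
  -- columns of `V'` from position `i` on: `n - 1` linear conditions on `n` coordinates.
  obtain ⟨z, hz0, hz⟩ := Matrix.exists_mulVec_eq_zero_iff.2
    (Matrix.det_eq_zero_of_row_eq_zero (A := Matrix.of fun r j : Fin n =>
      if (r : ℕ) < i then (V'ᴴ * V) r j else if (r : ℕ) = i then 0
        else (1 : Matrix (Fin n) (Fin n) 𝕜) r j) ⟨i, hi⟩ (by simp))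
  let c : Matrix (Fin n) (Fin 1) 𝕜 := Matrix.of fun j _ => z j
  have hc : ∀ j : Fin n, i < j → c j 0 = 0 := fun j hj => by
    have h := congrFun hz j
    have h1 : ¬ (j : ℕ) < i := by omega
    have h2 : ¬ (j : ℕ) = i := by omega
    change z j = 0
    simpa [Matrix.mulVec, dotProduct, h1, h2, Matrix.one_apply] using h
  have hc' : ∀ j : Fin n, (j : ℕ) < i → (V'ᴴ * V * c) j 0 = 0 := fun j hj => by
    have h := congrFun hz j
    rw [Matrix.mul_apply]
    simpa only [Matrix.mulVec, dotProduct, hj, Matrix.of_apply, if_true, Pi.zero_apply, c] using h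
  have hcne : 0 < ‖c‖ := by
    rw [norm_pos_iff]
    intro h
    refine hz0 (funext fun j => ?_)
    exact congrFun (congrFun h j) 0
  have eA : A * (V * c) = U * (rectDiagonal 𝕜 m n s * c) := by
    rw [hA, Matrix.mul_assoc, ← Matrix.mul_assoc Vᴴ, hV1, Matrix.one_mul, Matrix.mul_assoc]
  have eB : B * (V * c) = U' * (rectDiagonal 𝕜 m n s' * (V'ᴴ * V * c)) := by
    rw [hB]
    simp only [Matrix.mul_assoc]
  have lA : s i * ‖c‖ ≤ ‖A * (V * c)‖ := by
    refine abs_le_of_sq_le_sq' ?_ (norm_nonneg _) |>.2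
    rw [eA, frobenius_norm_isometry_mul hU1, norm_sq_rectDiagonal_mul hm, mul_pow,
      frobenius_norm_sq, Finset.mul_sum]
    refine Finset.sum_le_sum fun j _ => ?_
    simp only [Fin.sum_univ_one]
    rcases le_or_gt (j : ℕ) i with h | h
    · gcongr
      · exact hs0 i
      · exact hs h
    · simp [hc j h]
  have lB : ‖B * (V * c)‖ ≤ s' i * ‖c‖ := by
    refine abs_le_of_sq_le_sq' ?_ (mul_nonneg (hs0' i) (norm_nonneg _)) |>.2
    have e : ‖c‖ = ‖V'ᴴ * V * c‖ := by
      rw [Matrix.mul_assoc, frobenius_norm_isometry_mul (by simpa using hV2'),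
        frobenius_norm_isometry_mul hV1]
    rw [eB, frobenius_norm_isometry_mul hU1', norm_sq_rectDiagonal_mul hm', mul_pow, e,
      frobenius_norm_sq, Finset.mul_sum]
    refine Finset.sum_le_sum fun j _ => ?_
    simp only [Fin.sum_univ_one]
    rcases lt_or_ge (j : ℕ) i with h | h
    · simp [hc' j h]
    · gcongr
      · exact hs0' j
      · exact hs' h
  have lE : ‖A * (V * c)‖ ≤ ‖B * (V * c)‖ + ‖A - B‖ * ‖c‖ := by
    have e : A * (V * c) = B * (V * c) + (A - B) * (V * c) := by
      rw [← Matrix.add_mul, add_sub_cancel]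
    rw [e]
    refine (norm_add_le _ _).trans ?_
    gcongr
    refine (Matrix.frobenius_norm_mul _ _).trans ?_
    rw [frobenius_norm_isometry_mul hV1]
  refine le_of_mul_le_mul_right ?_ hcne
  calc s i * ‖c‖ ≤ s' i * ‖c‖ + ‖A - B‖ * ‖c‖ := lA.trans (lE.trans (by gcongr))
    _ = _ := by ring

theorem abs_singVal_sub_le (A B : Matrix (Fin m) (Fin n) 𝕜) (i : ℕ) :
    |singVal A i - singVal B i| ≤ ‖A - B‖ := by
  rcases lt_or_ge i n with hi | hi
  · obtain ⟨U, V, hU, hV, hA⟩ := exists_isFullSVD A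
    obtain ⟨U', V', hU', hV', hB⟩ := exists_isFullSVD B
    have h1 := diagonal_le_add_norm_sub hU hU' hV hV' hA hB (singVal_antitone A)
      (singVal_antitone B) (singVal_nonneg A) (singVal_nonneg B)
      (fun _ => singVal_eq_zero_of_le_row A) (fun _ => singVal_eq_zero_of_le_row B) hi
    have h2 := diagonal_le_add_norm_sub hU' hU hV' hV hB hA (singVal_antitone B)
      (singVal_antitone A) (singVal_nonneg B) (singVal_nonneg A)
      (fun _ => singVal_eq_zero_of_le_row B) (fun _ => singVal_eq_zero_of_le_row A) hi
    rw [norm_sub_rev] at h2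
    rw [abs_le]
    constructor <;> linarith
  · simp [singVal_of_le _ hi]

theorem continuous_singVal (i : ℕ) :
    Continuous fun A : Matrix (Fin m) (Fin n) 𝕜 => singVal A i := by
  refine continuous_iff_continuousAt.2 fun A => ?_
  rw [ContinuousAt, tendsto_iff_dist_tendsto_zero]
  refine squeeze_zero (fun _ => dist_nonneg) (fun B => ?_) (tendsto_frobDist A)
  rw [Real.dist_eq, frobDist_eq_norm, norm_sub_rev]
  exact abs_singVal_sub_le B A i

/-- The diagonal of a decomposition `U * Σ * Vᴴ` with decreasing nonnegative diagonal consists of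
the singular values. -/
theorem singVal_eq_of_eq_mul_rectDiagonal {A : Matrix (Fin m) (Fin n) 𝕜}
    {U : Matrix (Fin m) (Fin m) 𝕜} {V : Matrix (Fin n) (Fin n) 𝕜} {s : ℕ → ℝ}
    (hU : U ∈ Matrix.unitaryGroup (Fin m) 𝕜) (hV : V ∈ Matrix.unitaryGroup (Fin n) 𝕜)
    (hA : A = U * rectDiagonal 𝕜 m n s * Vᴴ) (hs : Antitone s) (hs0 : ∀ i, 0 ≤ s i)
    (hm : ∀ i, m ≤ i → s i = 0) (hn : ∀ i, n ≤ i → s i = 0) : singVal A = s := by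
  funext i
  rcases lt_or_ge i n with hi | hi
  · obtain ⟨U', V', hU', hV', hA'⟩ := exists_isFullSVD A
    have h1 := diagonal_le_add_norm_sub hU hU' hV hV' hA hA' hs (singVal_antitone A) hs0
      (singVal_nonneg A) hm (fun _ => singVal_eq_zero_of_le_row A) hi
    have h2 := diagonal_le_add_norm_sub hU' hU hV' hV hA' hA (singVal_antitone A) hs
      (singVal_nonneg A) hs0 (fun _ => singVal_eq_zero_of_le_row A) hm hi
    rw [sub_self, norm_zero, add_zero] at h1 h2
    exact h2.antisymm h1
  · rw [singVal_of_le A hi, hn i hi]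

end Weyl

/-! ### The set of good matrices is open, and its closure -/

section GoodSet

variable {𝕜 : Type*} [RCLike 𝕜] {m n : ℕ}

/-- Goodness means that the positions in `π` and the positions outside have no singular value in
common. -/
theorem mem_goodSet_iff {π : Finset (Fin m)} {A : Matrix (Fin m) (Fin n) 𝕜} :
    A ∈ goodSet 𝕜 m n π ↔ ∀ i ∈ π, ∀ j ∉ π, singVal A i ≠ singVal A j := by
  classical
  constructor
  · rintro ⟨U, V, h, S, hS, hW⟩ i hi j hj hij
    have e := hW.trans (leftSingularSubspace_eq_columnSpan h hS)
    have h1 := columnSpan_injective h.1 e.le hi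
    have h2 : j ∈ π := columnSpan_injective h.1 e.ge (by
      simp only [Finset.mem_filter, Finset.mem_univ, true_and] at h1 ⊢
      rwa [← hij])
    exact hj h2
  · intro h
    obtain ⟨U, V, hUV⟩ := exists_isFullSVD A
    have hS : (fun i : Fin m => singVal A i) '' π ⊆ Set.range (singVal A) := by
      rintro _ ⟨i, _, rfl⟩
      exact ⟨i, rfl⟩
    refine ⟨U, V, hUV, _, hS, ?_⟩
    rw [leftSingularSubspace_eq_columnSpan hUV hS]
    congr 1
    ext j
    simp only [Set.mem_image, Finset.mem_coe, Finset.mem_filter, Finset.mem_univ, true_and]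
    refine ⟨fun hj => ⟨j, hj, rfl⟩, ?_⟩
    rintro ⟨i, hi, hij⟩
    by_contra hj
    exact h i hi j hj hij

theorem isOpen_goodSet (π : Finset (Fin m)) : IsOpen (goodSet 𝕜 m n π) := by
  have : goodSet 𝕜 m n π = ⋂ i ∈ π, ⋂ j ∈ πᶜ,
      {A : Matrix (Fin m) (Fin n) 𝕜 | singVal A i ≠ singVal A j} := by
    ext A
    simp [mem_goodSet_iff]
  rw [this]
  refine isOpen_biInter_finset fun i _ => isOpen_biInter_finset fun j _ => ?_
  exact isOpen_ne_fun (continuous_singVal _) (continuous_singVal _)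

/-- Every matrix is a limit of good ones, obtained by separating its singular values. -/
theorem closure_goodSet {π : Finset (Fin m)}
    (hπ : ∀ i j : Fin m, n ≤ (i : ℕ) → n ≤ (j : ℕ) → (i ∈ π ↔ j ∈ π)) :
    closure (goodSet 𝕜 m n π) = Set.univ := by
  refine Set.eq_univ_of_forall fun A => ?_
  obtain ⟨U, V, hU, hV, hA⟩ := exists_isFullSVD A
  -- adding the strictly decreasing `ε / (i + 1)` makes the entries on the diagonal distinct and
  -- positive; the positions from `min m n` on stay zero
  let s : ℝ → ℕ → ℝ := fun ε i =>
    if i < m ∧ i < n then singVal A i + ε * (1 / ((i : ℝ) + 1)) else 0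
  let B : ℝ → Matrix (Fin m) (Fin n) 𝕜 := fun ε => U * rectDiagonal 𝕜 m n (s ε) * Vᴴ
  have hB0 : B 0 = A := by
    conv_rhs => rw [hA]
    simp only [B]
    congr 2
    ext i j
    by_cases h : (i : ℕ) = j
    · have : (i : ℕ) < n := h ▸ j.2
      simp [rectDiagonal, singValMatrix, s, h]
    · simp [rectDiagonal, singValMatrix, h]
  have hBc : Continuous B := by
    simp only [B]
    refine (continuous_const.matrix_mul ?_).matrix_mul continuous_const
    refine continuous_matrix fun i j => ?_
    simp only [rectDiagonal, Matrix.of_apply, s]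
    split_ifs <;> fun_prop
  have hlim : Filter.Tendsto B (nhdsWithin 0 (Set.Ioi 0)) (nhds A) := by
    rw [← hB0]
    exact (hBc.tendsto 0).mono_left nhdsWithin_le_nhds
  refine mem_closure_of_tendsto hlim ?_
  filter_upwards [self_mem_nhdsWithin] with ε (hε : 0 < ε)
  have hstrict : ∀ i j : ℕ, i < j → j < m → j < n → s ε j < s ε i := by
    intro i j hij hm hn
    simp only [s, hm, hn, hij.trans hm, hij.trans hn, and_self, if_true]
    have h1 := singVal_antitone A hij.le
    have h2 : 1 / ((j : ℝ) + 1) < 1 / ((i : ℝ) + 1) := by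
      have : (i : ℝ) < j := by exact_mod_cast hij
      gcongr
    have := mul_lt_mul_of_pos_left h2 hε
    linarith
  have hpos : ∀ i : ℕ, i < m → i < n → 0 < s ε i := by
    intro i hm hn
    simp only [s, hm, hn, and_self, if_true]
    have := singVal_nonneg A i
    positivity
  have hzero : ∀ i : ℕ, ¬ (i < m ∧ i < n) → s ε i = 0 := fun i h => by simp only [s, if_neg h]
  have hnn : ∀ i, 0 ≤ s ε i := fun i => by
    by_cases h : i < m ∧ i < n
    · exact (hpos i h.1 h.2).le
    · exact (hzero i h).ge
  have hanti : Antitone (s ε) := by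
    intro i j hij
    by_cases h : j < m ∧ j < n
    · rcases hij.eq_or_lt with rfl | hij
      · exact le_rfl
      · exact (hstrict i j hij h.1 h.2).le
    · rw [hzero j h]
      exact hnn i
  have hsv : singVal (B ε) = s ε :=
    singVal_eq_of_eq_mul_rectDiagonal hU hV rfl hanti hnn (fun i hi => hzero i (by omega))
      (fun i hi => hzero i (by omega))
  rw [mem_goodSet_iff, hsv]
  intro i hi j hj
  rcases lt_or_ge (i : ℕ) n with hin | hin <;> rcases lt_or_ge (j : ℕ) n with hjn | hjn
  · rcases lt_trichotomy (i : ℕ) j with h | h | h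
    · exact (hstrict i j h j.2 hjn).ne'
    · exact absurd (Fin.ext h ▸ hi) hj
    · exact (hstrict j i h i.2 hin).ne
  · rw [hzero j (by omega)]
    exact (hpos i i.2 hin).ne'
  · rw [hzero i (by omega)]
    exact (hpos j j.2 hjn).ne
  · exact absurd ((hπ i j hin hjn).1 hi) hj

end GoodSet

/-! ### Comparison of the distances on the Grassmannian -/

section GrassmannDistances

variable {𝕜 : Type*} [RCLike 𝕜] {d p : ℕ}

theorem singVal_conjTranspose_mul_le_one {Q Q' : Matrix (Fin p) (Fin d) 𝕜} (hQ : Qᴴ * Q = 1)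
    (hQ' : Q'ᴴ * Q' = 1) (i : Fin d) : singVal (Qᴴ * Q') i ≤ 1 := by
  obtain ⟨U, V, hU, hV, hM⟩ := exists_isFullSVD (Qᴴ * Q')
  have hU1 : Uᴴ * U = 1 := Matrix.mem_unitaryGroup_iff'.1 hU
  have hV1 : Vᴴ * V = 1 := Matrix.mem_unitaryGroup_iff'.1 hV
  set X := Q * U with hX
  set Y := Q' * V with hY
  have hXX : Xᴴ * X = 1 := by
    rw [hX, Matrix.conjTranspose_mul, Matrix.mul_assoc, ← Matrix.mul_assoc Qᴴ, hQ,
      Matrix.one_mul, hU1]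
  have hYY : Yᴴ * Y = 1 := by
    rw [hY, Matrix.conjTranspose_mul, Matrix.mul_assoc, ← Matrix.mul_assoc Q'ᴴ, hQ',
      Matrix.one_mul, hV1]
  have hXY : Xᴴ * Y = singValMatrix (Qᴴ * Q') := by
    calc Xᴴ * Y = Uᴴ * (Qᴴ * Q') * V := by
          rw [hX, hY, Matrix.conjTranspose_mul]
          simp only [Matrix.mul_assoc]
      _ = Uᴴ * (U * singValMatrix (Qᴴ * Q') * Vᴴ) * V := by rw [← hM]
      _ = (Uᴴ * U) * singValMatrix (Qᴴ * Q') * (Vᴴ * V) := by simp only [Matrix.mul_assoc]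
      _ = _ := by rw [hU1, hV1, Matrix.one_mul, Matrix.mul_one]
  have hYX : Yᴴ * X = (singValMatrix (Qᴴ * Q'))ᴴ := by
    rw [← hXY, Matrix.conjTranspose_mul Xᴴ, Matrix.conjTranspose_conjTranspose]
  -- the squared distance of the `i`-th columns of `X` and `Y` is `2 - 2 * singVal (Qᴴ * Q') i`
  have e : ((X - Y)ᴴ * (X - Y)) i i
      = ((1 - singVal (Qᴴ * Q') i - (singVal (Qᴴ * Q') i - 1) : ℝ) : 𝕜) := by
    rw [Matrix.conjTranspose_sub, Matrix.sub_mul, Matrix.mul_sub, Matrix.mul_sub, hXX, hYY, hXY,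
      hYX]
    simp [singValMatrix]
  have e' : ((X - Y)ᴴ * (X - Y)) i i = ((∑ a, ‖(X - Y) a i‖ ^ 2 : ℝ) : 𝕜) := by
    rw [Matrix.mul_apply]
    push_cast
    refine Finset.sum_congr rfl fun a _ => ?_
    rw [← RCLike.conj_mul, Matrix.conjTranspose_apply]
    rfl
  have h := RCLike.ofReal_injective (e'.symm.trans e)
  have : 0 ≤ ∑ a, ‖(X - Y) a i‖ ^ 2 := by positivity
  linarith

/-- The Frobenius norm in terms of singular values. -/
theorem sum_sq_singVal (M : Matrix (Fin d) (Fin d) 𝕜) :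
    ∑ i : Fin d, singVal M i ^ 2 = ‖M‖ ^ 2 := by
  obtain ⟨U, V, hU, hV, hM⟩ := exists_isFullSVD M
  have hU1 : Uᴴ * U = 1 := Matrix.mem_unitaryGroup_iff'.1 hU
  have hV1 : Vᴴ * V = 1 := Matrix.mem_unitaryGroup_iff'.1 hV
  conv_rhs => rw [hM]
  rw [frobenius_norm_mul_coisometry (by simpa using hV1), frobenius_norm_isometry_mul hU1]
  have h := norm_sq_rectDiagonal_mul (𝕜 := 𝕜) (m := d) (s := singVal M)
    (fun _ => singVal_eq_zero_of_le_row M) (1 : Matrix (Fin d) (Fin d) 𝕜)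
  rw [Matrix.mul_one] at h
  refine Eq.trans ?_ h.symm
  refine Finset.sum_congr rfl fun j _ => ?_
  simp [Matrix.one_apply, apply_ite]

theorem Gr.basisMatrix_orthonormal (P : Gr 𝕜 d p) : P.basisMatrixᴴ * P.basisMatrix = 1 :=
  P.2.choose_spec.1

theorem Gr.eq_basisMatrix (P : Gr 𝕜 d p) : P.1 = P.basisMatrix * P.basisMatrixᴴ :=
  P.2.choose_spec.2

theorem Gr.conjTranspose_val (P : Gr 𝕜 d p) : P.1ᴴ = P.1 := by
  rw [P.eq_basisMatrix, Matrix.conjTranspose_mul, Matrix.conjTranspose_conjTranspose]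

theorem Gr.mul_self (P : Gr 𝕜 d p) : P.1 * P.1 = P.1 := by
  rw [P.eq_basisMatrix, Matrix.mul_assoc, ← Matrix.mul_assoc P.basisMatrixᴴ,
    P.basisMatrix_orthonormal, Matrix.one_mul]

theorem cos_principalAngles (P P' : Gr 𝕜 d p) (i : Fin d) :
    Real.cos (principalAngles P P' i) = singVal (P.basisMatrixᴴ * P'.basisMatrix) i :=
  Real.cos_arccos (by linarith [singVal_nonneg (P.basisMatrixᴴ * P'.basisMatrix) i])
    (singVal_conjTranspose_mul_le_one P.basisMatrix_orthonormal P'.basisMatrix_orthonormal i)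

theorem sq_chordal (P P' : Gr 𝕜 d p) : grDist .chordal P P' ^ 2
    = d - ‖P.basisMatrixᴴ * P'.basisMatrix‖ ^ 2 := by
  rw [grDist, Real.sq_sqrt (by positivity), ← sum_sq_singVal]
  simp only [Real.sin_sq, cos_principalAngles, Finset.sum_sub_distrib]
  simp

theorem grDist_nonneg (D : GrDistance) (P P' : Gr 𝕜 d p) : 0 ≤ grDist D P P' := by
  cases D <;> exact Real.sqrt_nonneg _

theorem sq_chordal_le (P P' : Gr 𝕜 d p) : grDist .chordal P P' ^ 2 ≤ d := by
  rw [sq_chordal]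
  linarith [sq_nonneg ‖P.basisMatrixᴴ * P'.basisMatrix‖]

theorem chordal_comm (P P' : Gr 𝕜 d p) : grDist .chordal P P' = grDist .chordal P' P := by
  rw [← sq_eq_sq₀ (grDist_nonneg _ _ _) (grDist_nonneg _ _ _), sq_chordal, sq_chordal,
    ← Matrix.frobenius_norm_conjTranspose]
  simp

/-- The chordal distance is the Frobenius norm of the part of one projector that is transversal to
the other. -/
theorem norm_one_sub_mul_eq_chordal (P P' : Gr 𝕜 d p) :
    ‖(1 - P.1) * P'.1‖ = grDist .chordal P P' := by
  rw [← sq_eq_sq₀ (norm_nonneg _) (grDist_nonneg _ _ _), sq_chordal]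
  have hQ := P.basisMatrix_orthonormal
  have hQ' := P'.basisMatrix_orthonormal
  have h1 : (1 - P.1) * (1 - P.1) = 1 - P.1 := by
    rw [Matrix.sub_mul, Matrix.one_mul, Matrix.mul_sub, Matrix.mul_one, P.mul_self]
    simp
  have e : ‖(1 - P.1) * P'.1‖ = ‖(1 - P.1) * P'.basisMatrix‖ := by
    rw [P'.eq_basisMatrix, ← Matrix.mul_assoc, frobenius_norm_mul_coisometry (by simpa using hQ')]
  rw [e]
  apply RCLike.ofReal_injective (K := 𝕜)
  rw [RCLike.ofReal_sub, frobenius_norm_sq_eq_trace, frobenius_norm_sq_eq_trace]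
  have e2 : ((1 - P.1) * P'.basisMatrix)ᴴ * ((1 - P.1) * P'.basisMatrix)
      = 1 - (P.basisMatrixᴴ * P'.basisMatrix)ᴴ * (P.basisMatrixᴴ * P'.basisMatrix) := by
    rw [Matrix.conjTranspose_mul, Matrix.conjTranspose_sub, P.conjTranspose_val,
      Matrix.conjTranspose_one, Matrix.mul_assoc, ← Matrix.mul_assoc (1 - P.1), h1, Matrix.sub_mul,
      Matrix.one_mul, Matrix.mul_sub, hQ', P.eq_basisMatrix]
    simp [Matrix.mul_assoc]
  rw [e2, Matrix.trace_sub, Matrix.trace_one]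
  simp

theorem mul_cos_le_sin {x : ℝ} (h0 : 0 ≤ x) (h1 : x ≤ Real.pi / 2) :
    x * Real.cos x ≤ Real.sin x := by
  rcases h1.eq_or_lt with rfl | h1
  · simp
  · have hc := Real.cos_pos_of_mem_Ioo ⟨by linarith [Real.pi_pos], h1⟩
    have := Real.le_tan h0 h1
    rwa [Real.tan_eq_sin_div_cos, le_div_iff₀ hc] at this

/-- Each of the three distances is at least the chordal distance, and it exceeds the chordal
distance `c` at most by the factor `1 / √(1 - c ^ 2)`. So they agree to first order. -/
theorem chordal_le_grDist_and_le (D : GrDistance) (P P' : Gr 𝕜 d p) :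
    grDist .chordal P P' ≤ grDist D P P' ∧
      √(1 - grDist .chordal P P' ^ 2) * grDist D P P' ≤ grDist .chordal P P' := by
  -- each distance is the norm of a vector `x` with `sin θ ≤ x ≤ θ`, and `θ * cos θ ≤ sin θ`
  obtain ⟨x, hx, hsin, hangle⟩ : ∃ x : Fin d → ℝ, grDist D P P' = √(∑ i, x i ^ 2) ∧
      (∀ i, Real.sin (principalAngles P P' i) ≤ x i) ∧ ∀ i, x i ≤ principalAngles P P' i := by
    have h0 : ∀ i, 0 ≤ principalAngles P P' i := fun i => Real.arccos_nonneg _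
    cases D
    · exact ⟨_, rfl, fun _ => le_rfl, fun i => Real.sin_le (h0 i)⟩
    · exact ⟨_, rfl, fun i => Real.sin_le (h0 i), fun _ => le_rfl⟩
    · refine ⟨_, rfl, fun i => ?_, fun i => ?_⟩
      · have hle : principalAngles P P' i ≤ Real.pi := Real.arccos_le_pi _
        have hs : 0 ≤ Real.sin (principalAngles P P' i / 2) :=
          Real.sin_nonneg_of_nonneg_of_le_pi (by linarith [h0 i]) (by linarith [h0 i])
        conv_lhs => rw [← mul_div_cancel₀ (principalAngles P P' i) (two_ne_zero' ℝ),
          Real.sin_two_mul]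
        exact mul_le_of_le_one_right (by positivity) (Real.cos_le_one _)
      · have := Real.sin_le (x := principalAngles P P' i / 2) (by linarith [h0 i])
        linarith
  have hs0 : ∀ i, 0 ≤ Real.sin (principalAngles P P' i) := fun i =>
    Real.sin_nonneg_of_nonneg_of_le_pi (Real.arccos_nonneg _) (Real.arccos_le_pi _)
  rw [hx]
  constructor
  · refine Real.sqrt_le_sqrt (Finset.sum_le_sum fun i _ => ?_)
    exact pow_le_pow_left₀ (hs0 i) (hsin i) 2
  · set c := grDist .chordal P P' with hc
    have hc2 : c ^ 2 = ∑ i, Real.sin (principalAngles P P' i) ^ 2 := by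
      rw [hc, grDist, Real.sq_sqrt (by positivity)]
    have hcs : c = √(∑ i, Real.sin (principalAngles P P' i) ^ 2) := rfl
    conv_rhs => rw [hcs]
    rw [← Real.sqrt_sq (Real.sqrt_nonneg (1 - c ^ 2)), ← Real.sqrt_mul (sq_nonneg _),
      Finset.mul_sum]
    refine Real.sqrt_le_sqrt (Finset.sum_le_sum fun i _ => ?_)
    rw [← mul_pow]
    have hx0 : 0 ≤ x i := (hs0 i).trans (hsin i)
    refine pow_le_pow_left₀ (by positivity) ?_ 2
    have hcos : √(1 - c ^ 2) ≤ Real.cos (principalAngles P P' i) := by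
      have hcos0 : 0 ≤ Real.cos (principalAngles P P' i) := by
        rw [cos_principalAngles]
        exact singVal_nonneg _ _
      refine Real.sqrt_le_iff.2 ⟨hcos0, ?_⟩
      have h1 : Real.sin (principalAngles P P' i) ^ 2 ≤ c ^ 2 := by
        rw [hc2]
        exact Finset.single_le_sum (f := fun i => Real.sin (principalAngles P P' i) ^ 2)
          (fun _ _ => sq_nonneg _) (Finset.mem_univ i)
      linarith [Real.sin_sq_add_cos_sq (principalAngles P P' i)]
    have hle : principalAngles P P' i ≤ Real.pi / 2 :=
      Real.arccos_le_pi_div_two.2 (singVal_nonneg _ _)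
    calc √(1 - c ^ 2) * x i ≤ Real.cos (principalAngles P P' i) * principalAngles P P' i :=
          mul_le_mul hcos (hangle i) hx0 ((Real.sqrt_nonneg _).trans hcos)
      _ ≤ _ := by
          rw [mul_comm]
          exact mul_cos_le_sin (Real.arccos_nonneg _) hle

end GrassmannDistances

/-! ### Projectors in a basis of singular vectors -/

section CoordinateProjectors

variable {𝕜 : Type*} [RCLike 𝕜] {l m n : ℕ}

/-- The coordinate projector on the positions in `ρ`. -/
def indicatorDiagonal (𝕜 : Type*) [RCLike 𝕜] (ρ : Finset (Fin m)) : Matrix (Fin m) (Fin m) 𝕜 :=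
  Matrix.diagonal fun i => if i ∈ ρ then 1 else 0

theorem one_sub_indicatorDiagonal (ρ : Finset (Fin m)) :
    1 - indicatorDiagonal 𝕜 ρ = indicatorDiagonal 𝕜 ρᶜ := by
  rw [indicatorDiagonal, indicatorDiagonal, ← Matrix.diagonal_one, Matrix.diagonal_sub]
  congr 1
  funext i
  by_cases h : i ∈ ρ <;> simp [h]

theorem conjTranspose_indicatorDiagonal (ρ : Finset (Fin m)) :
    (indicatorDiagonal 𝕜 ρ)ᴴ = indicatorDiagonal 𝕜 ρ := by
  rw [indicatorDiagonal, Matrix.diagonal_conjTranspose]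
  congr 1
  funext i
  simp [apply_ite]

theorem norm_sq_indicatorDiagonal_mul (ρ : Finset (Fin m)) (M : Matrix (Fin m) (Fin n) 𝕜) :
    ‖indicatorDiagonal 𝕜 ρ * M‖ ^ 2 = ∑ j ∈ ρ, ∑ i, ‖M j i‖ ^ 2 := by
  rw [frobenius_norm_sq, indicatorDiagonal]
  simp only [Matrix.diagonal_mul]
  rw [← Finset.sum_subset (Finset.subset_univ ρ)]
  · exact Finset.sum_congr rfl fun j hj => by simp [hj]
  · intro j _ hj
    simp [hj]

theorem norm_sq_indicatorDiagonal_mul_mul (ρ : Finset (Fin m)) (π : Finset (Fin n))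
    (M : Matrix (Fin m) (Fin n) 𝕜) :
    ‖indicatorDiagonal 𝕜 ρ * M * indicatorDiagonal 𝕜 π‖ ^ 2
      = ∑ j ∈ ρ, ∑ i ∈ π, ‖M j i‖ ^ 2 := by
  rw [Matrix.mul_assoc, norm_sq_indicatorDiagonal_mul]
  refine Finset.sum_congr rfl fun j _ => ?_
  rw [← Finset.sum_subset (Finset.subset_univ π)]
  · exact Finset.sum_congr rfl fun i hi => by simp [indicatorDiagonal, hi]
  · intro i _ hi
    simp [indicatorDiagonal, hi]

theorem norm_indicatorDiagonal_mul_le (ρ : Finset (Fin m)) (M : Matrix (Fin m) (Fin n) 𝕜) :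
    ‖indicatorDiagonal 𝕜 ρ * M‖ ≤ ‖M‖ := by
  refine abs_le_of_sq_le_sq' ?_ (norm_nonneg _) |>.2
  rw [norm_sq_indicatorDiagonal_mul, frobenius_norm_sq]
  exact Finset.sum_le_univ_sum_of_nonneg fun j => by positivity

theorem norm_mul_indicatorDiagonal_le (π : Finset (Fin n)) (M : Matrix (Fin m) (Fin n) 𝕜) :
    ‖M * indicatorDiagonal 𝕜 π‖ ≤ ‖M‖ := by
  rw [← Matrix.frobenius_norm_conjTranspose, Matrix.conjTranspose_mul,
    conjTranspose_indicatorDiagonal, ← Matrix.frobenius_norm_conjTranspose M]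
  exact norm_indicatorDiagonal_mul_le π _

theorem selectColumns_mul_conjTranspose (U : Matrix (Fin m) (Fin m) 𝕜) (π : Finset (Fin m)) :
    selectColumns U π * (selectColumns U π)ᴴ = U * indicatorDiagonal 𝕜 π * Uᴴ := by
  ext a b
  rw [Matrix.mul_apply, Matrix.mul_apply]
  simp only [indicatorDiagonal, Matrix.mul_diagonal, selectColumns, Matrix.submatrix_apply,
    Matrix.conjTranspose_apply, id]
  have h : ∑ i ∈ π, U a i * star (U b i)
      = ∑ j, (U a j * if j ∈ π then 1 else 0) * star (U b j) := by
    rw [← Finset.sum_subset (Finset.subset_univ π)]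
    · exact Finset.sum_congr rfl fun i hi => by simp [hi]
    · intro i _ hi
      simp [hi]
  rw [← h]
  conv_rhs => rw [← Finset.map_orderEmbOfFin_univ π rfl]
  rw [Finset.sum_map]
  rfl

theorem leftMap_eq_mul_indicatorDiagonal (π : Finset (Fin m)) (A : goodSet 𝕜 m n π)
    {U : Matrix (Fin m) (Fin m) 𝕜} {V : Matrix (Fin n) (Fin n) 𝕜} (h : IsFullSVD A.1 U V) :
    (leftMap π A).1 = U * indicatorDiagonal 𝕜 π * Uᴴ := by
  rw [leftMap_eq π A h, selectColumns_mul_conjTranspose]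

theorem one_sub_conj_indicatorDiagonal {U : Matrix (Fin m) (Fin m) 𝕜} (hU : U * Uᴴ = 1)
    (π : Finset (Fin m)) :
    1 - U * indicatorDiagonal 𝕜 π * Uᴴ = U * indicatorDiagonal 𝕜 πᶜ * Uᴴ := by
  rw [← one_sub_indicatorDiagonal, Matrix.mul_sub, Matrix.sub_mul, Matrix.mul_one, hU]

theorem norm_conj_indicatorDiagonal_mul {U : Matrix (Fin m) (Fin m) 𝕜} (hU : Uᴴ * U = 1)
    (ρ : Finset (Fin m)) (M : Matrix (Fin m) (Fin n) 𝕜) :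
    ‖U * indicatorDiagonal 𝕜 ρ * Uᴴ * M‖ = ‖indicatorDiagonal 𝕜 ρ * (Uᴴ * M)‖ := by
  rw [Matrix.mul_assoc, Matrix.mul_assoc, frobenius_norm_isometry_mul hU]

end CoordinateProjectors

section GrassmannProjectors

variable {𝕜 : Type*} [RCLike 𝕜] {d p l : ℕ}

/-- Pythagoras for an orthogonal projector, columnwise. -/
theorem Gr.norm_sq_add_norm_sq (P : Gr 𝕜 d p) (M : Matrix (Fin p) (Fin l) 𝕜) :
    ‖(1 - P.1) * M‖ ^ 2 + ‖P.1 * M‖ ^ 2 = ‖M‖ ^ 2 := by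
  apply RCLike.ofReal_injective (K := 𝕜)
  rw [RCLike.ofReal_add, frobenius_norm_sq_eq_trace, frobenius_norm_sq_eq_trace,
    frobenius_norm_sq_eq_trace, ← Matrix.trace_add]
  congr 1
  have h := P.mul_self
  have h' := P.conjTranspose_val
  generalize P.1 = X at h h'
  rw [Matrix.conjTranspose_mul, Matrix.conjTranspose_mul, Matrix.conjTranspose_sub, h',
    Matrix.conjTranspose_one, Matrix.mul_assoc, ← Matrix.mul_assoc (1 - X), Matrix.mul_assoc Mᴴ X,
    ← Matrix.mul_assoc X X, h, Matrix.sub_mul 1 X, Matrix.one_mul, Matrix.mul_sub X, Matrix.mul_one,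
    h, sub_self, sub_zero, Matrix.sub_mul, Matrix.one_mul, Matrix.mul_sub, sub_add_cancel]

theorem Gr.norm_mul_le (P : Gr 𝕜 d p) (M : Matrix (Fin p) (Fin l) 𝕜) : ‖P.1 * M‖ ≤ ‖M‖ := by
  refine abs_le_of_sq_le_sq' ?_ (norm_nonneg _) |>.2
  linarith [sq_nonneg ‖(1 - P.1) * M‖, P.norm_sq_add_norm_sq M]

theorem norm_mul_one_sub_eq_chordal (P P' : Gr 𝕜 d p) :
    ‖P'.1 * (1 - P.1)‖ = grDist .chordal P P' := by
  rw [← norm_one_sub_mul_eq_chordal, ← Matrix.frobenius_norm_conjTranspose,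
    Matrix.conjTranspose_mul, Matrix.conjTranspose_sub, Matrix.conjTranspose_one,
    P.conjTranspose_val, P'.conjTranspose_val]

theorem norm_mul_le_norm_mul_add_chordal (P P' : Gr 𝕜 d p) (M : Matrix (Fin p) (Fin l) 𝕜) :
    ‖P'.1 * M‖ ≤ ‖P.1 * M‖ + grDist .chordal P P' * ‖M‖ := by
  have e : P'.1 * M = P'.1 * (P.1 * M) + P'.1 * (1 - P.1) * M := by
    rw [Matrix.mul_sub P'.1, Matrix.mul_one, Matrix.sub_mul, Matrix.mul_assoc, add_sub_cancel]
  rw [e, ← norm_mul_one_sub_eq_chordal]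
  exact (norm_add_le _ _).trans (add_le_add (P'.norm_mul_le _) (Matrix.frobenius_norm_mul _ _))

end GrassmannProjectors

section RightSingularVectors

variable {𝕜 : Type*} [RCLike 𝕜] {m n : ℕ}

/-- The singular values of `A` as an `m × m` diagonal matrix, padded with zeros. -/
noncomputable def singValDiagonal (A : Matrix (Fin m) (Fin n) 𝕜) : Matrix (Fin m) (Fin m) 𝕜 :=
  Matrix.diagonal fun i => ((singVal A i : ℝ) : 𝕜)

theorem conjTranspose_singValDiagonal (A : Matrix (Fin m) (Fin n) 𝕜) :
    (singValDiagonal A)ᴴ = singValDiagonal A := by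
  rw [singValDiagonal, Matrix.diagonal_conjTranspose]
  congr 1
  funext i
  simp

/-- The right singular vectors, cut off or padded with zeros to an `n × m` matrix `R`. -/
theorem IsFullSVD.exists_right {A : Matrix (Fin m) (Fin n) 𝕜} {U : Matrix (Fin m) (Fin m) 𝕜}
    {V : Matrix (Fin n) (Fin n) 𝕜} (h : IsFullSVD A U V) :
    ∃ R : Matrix (Fin n) (Fin m) 𝕜, Aᴴ * U = R * singValDiagonal A ∧
      ∀ (l : ℕ) (M : Matrix (Fin l) (Fin n) 𝕜), ‖M * R‖ ≤ ‖M‖ := by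
  obtain ⟨hU, hV, hA⟩ := h
  have hU1 : Uᴴ * U = 1 := Matrix.mem_unitaryGroup_iff'.1 hU
  have hV2 : V * Vᴴ = 1 := Matrix.mem_unitaryGroup_iff.1 hV
  let s : ℕ → ℝ := fun i => if i < m then 1 else 0
  refine ⟨V * (rectDiagonal 𝕜 m n s)ᴴ, ?_, fun l M => ?_⟩
  · have hS : singValMatrix A = singValDiagonal A * rectDiagonal 𝕜 m n s := by
      ext i j
      simp [singValMatrix, singValDiagonal, rectDiagonal, s]
    conv_lhs => rw [hA, hS]
    simp only [Matrix.conjTranspose_mul, Matrix.conjTranspose_conjTranspose, Matrix.mul_assoc, hU1,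
      conjTranspose_singValDiagonal, Matrix.mul_one]
  · rw [← Matrix.mul_assoc, ← frobenius_norm_mul_coisometry hV2 M,
      ← Matrix.frobenius_norm_conjTranspose, Matrix.conjTranspose_mul,
      Matrix.conjTranspose_conjTranspose, ← Matrix.frobenius_norm_conjTranspose (M * V)]
    refine abs_le_of_sq_le_sq' ?_ (norm_nonneg _) |>.2
    rw [norm_sq_rectDiagonal_mul (by intro i hi; simp [s, not_lt.2 hi]), frobenius_norm_sq]
    refine Finset.sum_le_sum fun j _ => mul_le_of_le_one_left (by positivity) ?_
    by_cases hj : (j : ℕ) < m <;> simp [s, hj]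

end RightSingularVectors

/-! ### The upper bound for the motion of a singular subspace -/

section UpperBound

variable {𝕜 : Type*} [RCLike 𝕜] {m n : ℕ}

/-- The reciprocal of the condition number for a pair of singular values `a` and `b`. The value at
`a = b = 0` is `0`, by division by zero; this is the continuous extension. -/
noncomputable def gapRatio (a b : ℝ) : ℝ := |a ^ 2 - b ^ 2| / √(a ^ 2 + b ^ 2)

/-- The entries of `W = Uᴴ * U'` are determined, for different singular values, by the perturbation
`E = A' - A` in the two bases of singular vectors. -/
theorem entry_mul_gap_eq {A A' : Matrix (Fin m) (Fin n) 𝕜} {U U' : Matrix (Fin m) (Fin m) 𝕜}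
    {V V' : Matrix (Fin n) (Fin n) 𝕜} (h : IsFullSVD A U V) (h' : IsFullSVD A' U' V')
    {R R' : Matrix (Fin n) (Fin m) 𝕜} (hR : Aᴴ * U = R * singValDiagonal A)
    (hR' : A'ᴴ * U' = R' * singValDiagonal A') (j i : Fin m) :
    (Uᴴ * U') j i * ((singVal A' i ^ 2 - singVal A j ^ 2 : ℝ) : 𝕜)
      = (Uᴴ * (A' - A) * R') j i * ((singVal A' i : ℝ) : 𝕜)
        + ((singVal A j : ℝ) : 𝕜) * (Rᴴ * (A' - A)ᴴ * U') j i := by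
  have hU1 : Uᴴ * U = 1 := Matrix.mem_unitaryGroup_iff'.1 h.1
  have hU1' : U'ᴴ * U' = 1 := Matrix.mem_unitaryGroup_iff'.1 h'.1
  have hR2 : singValDiagonal A * Rᴴ = Uᴴ * A := by
    rw [← conjTranspose_singValDiagonal, ← Matrix.conjTranspose_mul, ← hR, Matrix.conjTranspose_mul,
      Matrix.conjTranspose_conjTranspose]
  have e1 : Uᴴ * (A' - A) * R' * singValDiagonal A'
      + singValDiagonal A * (Rᴴ * (A' - A)ᴴ * U') = Uᴴ * (A' * A'ᴴ) * U' - Uᴴ * (A * Aᴴ) * U' := by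
    rw [Matrix.mul_assoc _ R', ← hR', Matrix.mul_assoc Rᴴ, ← Matrix.mul_assoc (singValDiagonal A),
      hR2, Matrix.conjTranspose_sub]
    simp only [Matrix.mul_sub, Matrix.sub_mul, Matrix.mul_assoc]
    abel
  have e2 : Uᴴ * (A' * A'ᴴ) * U' - Uᴴ * (A * Aᴴ) * U'
      = Uᴴ * U' * Matrix.diagonal (fun i : Fin m => ((singVal A' i ^ 2 : ℝ) : 𝕜))
        - Matrix.diagonal (fun i : Fin m => ((singVal A i ^ 2 : ℝ) : 𝕜)) * (Uᴴ * U') := by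
    rw [h.mul_col, h'.mul_col]
    congr 1
    · simp only [Matrix.mul_assoc, hU1', Matrix.mul_one]
    · simp only [← Matrix.mul_assoc, hU1, Matrix.one_mul]
  have e3 := congrFun (congrFun (e1.trans e2) j) i
  rw [Matrix.add_apply, Matrix.sub_apply, Matrix.mul_diagonal, Matrix.diagonal_mul,
    singValDiagonal, singValDiagonal, Matrix.mul_diagonal, Matrix.diagonal_mul] at e3
  rw [e3]
  push_cast
  ring

/-- The Cauchy–Schwarz step of the sine theorem, for one entry. The hypothesis
`1 ≤ q * gapRatio a b` also excludes `a = b`. -/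
theorem norm_sq_le_of_gapRatio {w f g : 𝕜} {a b q : ℝ} (ha : 0 ≤ a) (hb : 0 ≤ b) (hq : 0 ≤ q)
    (hgap : 1 ≤ q * gapRatio a b)
    (hid : w * ((a ^ 2 - b ^ 2 : ℝ) : 𝕜) = f * (a : 𝕜) + (b : 𝕜) * g) :
    ‖w‖ ^ 2 ≤ q ^ 2 * (‖f‖ ^ 2 + ‖g‖ ^ 2) := by
  have hroot : 0 < √(a ^ 2 + b ^ 2) := by
    rcases (Real.sqrt_nonneg (a ^ 2 + b ^ 2)).eq_or_lt with h0 | h0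
    · rw [gapRatio, ← h0, div_zero, mul_zero] at hgap
      linarith
    · exact h0
  rw [gapRatio, ← mul_div_assoc, one_le_div hroot] at hgap
  have h1 : ‖w‖ * |a ^ 2 - b ^ 2| ≤ a * ‖f‖ + b * ‖g‖ := by
    have hid' := congrArg norm hid
    rw [norm_mul, RCLike.norm_ofReal] at hid'
    rw [hid']
    refine (norm_add_le _ _).trans (le_of_eq ?_)
    rw [norm_mul, norm_mul, RCLike.norm_ofReal, RCLike.norm_ofReal, abs_of_nonneg ha,
      abs_of_nonneg hb]
    ring
  have h2 : a * ‖f‖ + b * ‖g‖ ≤ √(a ^ 2 + b ^ 2) * √(‖f‖ ^ 2 + ‖g‖ ^ 2) := by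
    rw [← Real.sqrt_mul (by positivity)]
    refine Real.le_sqrt_of_sq_le ?_
    nlinarith [sq_nonneg (a * ‖g‖ - b * ‖f‖)]
  have h3 : ‖w‖ * √(a ^ 2 + b ^ 2) ≤ (q * √(‖f‖ ^ 2 + ‖g‖ ^ 2)) * √(a ^ 2 + b ^ 2) := by
    calc ‖w‖ * √(a ^ 2 + b ^ 2) ≤ ‖w‖ * (q * |a ^ 2 - b ^ 2|) := by gcongr
      _ = q * (‖w‖ * |a ^ 2 - b ^ 2|) := by ring
      _ ≤ q * (√(a ^ 2 + b ^ 2) * √(‖f‖ ^ 2 + ‖g‖ ^ 2)) :=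
          mul_le_mul_of_nonneg_left (h1.trans h2) hq
      _ = _ := by ring
  have h4 := pow_le_pow_left₀ (norm_nonneg _) (le_of_mul_le_mul_right h3 hroot) 2
  rwa [mul_pow, Real.sq_sqrt (by positivity)] at h4

/-- A sine theorem with the sharp constant, up to the factor `1 + c` that comes from the second
projector. -/
theorem chordal_le_of_gapRatio (π : Finset (Fin m)) (A A' : goodSet 𝕜 m n π) {q : ℝ} (hq0 : 0 ≤ q)
    (hq : ∀ i ∈ π, ∀ j ∉ π, 1 ≤ q * gapRatio (singVal A'.1 i) (singVal A.1 j)) :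
    grDist .chordal (leftMap π A) (leftMap π A')
      ≤ q * ‖A'.1 - A.1‖ * (1 + grDist .chordal (leftMap π A) (leftMap π A')) := by
  obtain ⟨U, V, h⟩ := exists_isFullSVD A.1
  obtain ⟨U', V', h'⟩ := exists_isFullSVD A'.1
  have hU1 : Uᴴ * U = 1 := Matrix.mem_unitaryGroup_iff'.1 h.1
  have hU1' : U'ᴴ * U' = 1 := Matrix.mem_unitaryGroup_iff'.1 h'.1
  have hU2 : U * Uᴴ = 1 := Matrix.mem_unitaryGroup_iff.1 h.1
  have hU2' : U' * U'ᴴ = 1 := Matrix.mem_unitaryGroup_iff.1 h'.1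
  obtain ⟨R, hR, hRc⟩ := h.exists_right
  obtain ⟨R', hR', hRc'⟩ := h'.exists_right
  have eP := leftMap_eq_mul_indicatorDiagonal π A h
  have eP' := leftMap_eq_mul_indicatorDiagonal π A' h'
  have eP1 := (congrArg (1 - ·) eP).trans (one_sub_conj_indicatorDiagonal hU2 π)
  have hid := entry_mul_gap_eq h h' hR hR'
  have hcW := norm_one_sub_mul_eq_chordal (leftMap π A) (leftMap π A')
  have hpyth := (leftMap π A).norm_sq_add_norm_sq (A'.1 - A.1)
  have hP'E := norm_mul_le_norm_mul_add_chordal (leftMap π A) (leftMap π A') (A'.1 - A.1)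
  have hc0 : 0 ≤ grDist .chordal (leftMap π A) (leftMap π A') := grDist_nonneg _ _ _
  generalize grDist .chordal (leftMap π A) (leftMap π A') = c at *
  generalize (leftMap π A).1 = P at *
  generalize (leftMap π A').1 = P' at *
  generalize A'.1 - A.1 = E at *
  generalize hF : Uᴴ * E * R' = F at *
  generalize hG : Rᴴ * Eᴴ * U' = G at *
  have hcW' : c = ‖indicatorDiagonal 𝕜 πᶜ * (Uᴴ * U') * indicatorDiagonal 𝕜 π‖ := by
    rw [← hcW, eP1, eP', norm_conj_indicatorDiagonal_mul hU1,
      ← frobenius_norm_mul_coisometry (Q := U'ᴴ) (by simpa using hU1')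
        (indicatorDiagonal 𝕜 πᶜ * (Uᴴ * U') * indicatorDiagonal 𝕜 π)]
    simp only [Matrix.mul_assoc]
  have hFb : ‖indicatorDiagonal 𝕜 πᶜ * F * indicatorDiagonal 𝕜 π‖ ≤ ‖(1 - P) * E‖ := by
    refine (norm_mul_indicatorDiagonal_le _ _).trans ?_
    rw [← hF, ← Matrix.mul_assoc, eP1, norm_conj_indicatorDiagonal_mul hU1]
    exact hRc' _ _
  have hGb : ‖indicatorDiagonal 𝕜 πᶜ * G * indicatorDiagonal 𝕜 π‖ ≤ ‖P' * E‖ := by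
    rw [Matrix.mul_assoc]
    refine (norm_indicatorDiagonal_mul_le _ _).trans ?_
    rw [eP', norm_conj_indicatorDiagonal_mul hU1', ← Matrix.frobenius_norm_conjTranspose, ← hG]
    simp only [Matrix.conjTranspose_mul, Matrix.conjTranspose_conjTranspose,
      conjTranspose_indicatorDiagonal]
    rw [← Matrix.mul_assoc, ← Matrix.mul_assoc, ← Matrix.mul_assoc]
    exact hRc _ _
  have hsq : c ^ 2 ≤ q ^ 2 * (‖(1 - P) * E‖ ^ 2 + ‖P' * E‖ ^ 2) := by
    calc c ^ 2 = ∑ j ∈ πᶜ, ∑ i ∈ π, ‖(Uᴴ * U') j i‖ ^ 2 := by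
          rw [hcW', norm_sq_indicatorDiagonal_mul_mul]
      _ ≤ ∑ j ∈ πᶜ, ∑ i ∈ π, q ^ 2 * (‖F j i‖ ^ 2 + ‖G j i‖ ^ 2) :=
          Finset.sum_le_sum fun j hj => Finset.sum_le_sum fun i hi =>
            norm_sq_le_of_gapRatio (singVal_nonneg _ _) (singVal_nonneg _ _) hq0
              (hq i hi j (Finset.mem_compl.1 hj)) (hid j i)
      _ = q ^ 2 * (‖indicatorDiagonal 𝕜 πᶜ * F * indicatorDiagonal 𝕜 π‖ ^ 2
            + ‖indicatorDiagonal 𝕜 πᶜ * G * indicatorDiagonal 𝕜 π‖ ^ 2) := by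
          rw [norm_sq_indicatorDiagonal_mul_mul, norm_sq_indicatorDiagonal_mul_mul]
          simp only [← Finset.mul_sum, Finset.sum_add_distrib]
      _ ≤ _ := mul_le_mul_of_nonneg_left (add_le_add (pow_le_pow_left₀ (norm_nonneg _) hFb 2)
          (pow_le_pow_left₀ (norm_nonneg _) hGb 2)) (sq_nonneg q)
  refine abs_le_of_sq_le_sq' (hsq.trans ?_) (by positivity) |>.2
  have hy : ‖P * E‖ ≤ ‖E‖ := by
    refine abs_le_of_sq_le_sq' ?_ (norm_nonneg _) |>.2
    linarith [sq_nonneg ‖(1 - P) * E‖]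
  have h5 := pow_le_pow_left₀ (norm_nonneg _) hP'E 2
  have h6 : c * ‖E‖ * ‖P * E‖ ≤ c * ‖E‖ * ‖E‖ := by gcongr
  rw [mul_assoc, mul_pow]
  refine mul_le_mul_of_nonneg_left ?_ (sq_nonneg q)
  nlinarith

end UpperBound

/-! ### The lower bound for the motion of a singular subspace -/

section LowerBound

variable {𝕜 : Type*} [RCLike 𝕜] {m n : ℕ}

/-- A singular subspace is invariant under `A * Aᴴ`. -/
theorem leftMap_mul_comm (π : Finset (Fin m)) (A : goodSet 𝕜 m n π) :
    (leftMap π A).1 * (A.1 * A.1ᴴ) = A.1 * A.1ᴴ * (leftMap π A).1 := by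
  obtain ⟨U, V, h⟩ := exists_isFullSVD A.1
  have hU1 : Uᴴ * U = 1 := Matrix.mem_unitaryGroup_iff'.1 h.1
  have key : ∀ X Y : Matrix (Fin m) (Fin m) 𝕜, U * X * Uᴴ * (U * Y * Uᴴ) = U * (X * Y) * Uᴴ := by
    intro X Y
    calc U * X * Uᴴ * (U * Y * Uᴴ) = U * X * (Uᴴ * U) * Y * Uᴴ := by simp only [Matrix.mul_assoc]
      _ = _ := by rw [hU1, Matrix.mul_one, Matrix.mul_assoc U]
  rw [leftMap_eq_mul_indicatorDiagonal π A h, h.mul_col, key, key, indicatorDiagonal,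
    Matrix.diagonal_mul_diagonal, Matrix.diagonal_mul_diagonal]
  simp only [mul_comm]

/-- A converse of the sine theorem: an off-diagonal entry of the perturbation of `A * Aᴴ` forces the
singular subspace to move. -/
theorem norm_entry_le_chordal_mul {π : Finset (Fin m)} (A A' : goodSet 𝕜 m n π)
    {U : Matrix (Fin m) (Fin m) 𝕜} {V : Matrix (Fin n) (Fin n) 𝕜} (h : IsFullSVD A.1 U V)
    {i j : Fin m} (hi : i ∈ π) (hj : j ∉ π) :
    ‖(Uᴴ * (A'.1 * A'.1ᴴ - A.1 * A.1ᴴ) * U) j i‖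
      ≤ grDist .chordal (leftMap π A) (leftMap π A')
        * (|singVal A.1 i ^ 2 - singVal A.1 j ^ 2| + 2 * ‖A'.1 * A'.1ᴴ - A.1 * A.1ᴴ‖) := by
  have hU1 : Uᴴ * U = 1 := Matrix.mem_unitaryGroup_iff'.1 h.1
  have hU2 : U * Uᴴ = 1 := Matrix.mem_unitaryGroup_iff.1 h.1
  have eP := leftMap_eq_mul_indicatorDiagonal π A h
  have eP1 := (congrArg (1 - ·) eP).trans (one_sub_conj_indicatorDiagonal hU2 π)
  have hN := leftMap_mul_comm π A
  have hN' := leftMap_mul_comm π A'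
  have hW := norm_one_sub_mul_eq_chordal (leftMap π A) (leftMap π A')
  have hW' := norm_one_sub_mul_eq_chordal (leftMap π A') (leftMap π A)
  rw [chordal_comm] at hW'
  have hmul := h.mul_col
  generalize grDist .chordal (leftMap π A) (leftMap π A') = c at *
  generalize (leftMap π A).1 = P at *
  generalize (leftMap π A').1 = P' at *
  generalize A.1 * A.1ᴴ = N at *
  generalize A'.1 * A'.1ᴴ = N' at *
  set a := singVal A.1 i with ha
  set b := singVal A.1 j with hb
  -- multiplication by `Uᴴ` and `U` does not increase entries beyond the Frobenius norm
  have hle : ∀ M : Matrix (Fin m) (Fin m) 𝕜, ‖(Uᴴ * M * U) j i‖ ≤ ‖M‖ := fun M => by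
    refine (norm_entry_le_frobenius _ _ _).trans (le_of_eq ?_)
    rw [frobenius_norm_mul_coisometry hU2, frobenius_norm_isometry_mul (by simpa using hU2)]
  have hrow : ∀ M : Matrix (Fin m) (Fin m) 𝕜, (Uᴴ * ((1 - P) * M) * U) j i = (Uᴴ * M * U) j i := by
    intro M
    have : Uᴴ * ((1 - P) * M) * U = indicatorDiagonal 𝕜 πᶜ * (Uᴴ * M * U) := by
      calc Uᴴ * ((1 - P) * M) * U = (Uᴴ * U) * indicatorDiagonal 𝕜 πᶜ * (Uᴴ * M * U) := by
            rw [eP1]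
            simp only [Matrix.mul_assoc]
        _ = _ := by rw [hU1, Matrix.one_mul]
    rw [this, indicatorDiagonal, Matrix.diagonal_mul, if_pos (Finset.mem_compl.2 hj), one_mul]
  have hcol : ∀ M : Matrix (Fin m) (Fin m) 𝕜, (Uᴴ * (M * P) * U) j i = (Uᴴ * M * U) j i := by
    intro M
    have : Uᴴ * (M * P) * U = (Uᴴ * M * U) * indicatorDiagonal 𝕜 π := by
      calc Uᴴ * (M * P) * U = (Uᴴ * M * U) * indicatorDiagonal 𝕜 π * (Uᴴ * U) := by
            rw [eP]
            simp only [Matrix.mul_assoc]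
        _ = _ := by rw [hU1, Matrix.mul_one]
    rw [this, indicatorDiagonal, Matrix.mul_diagonal, if_pos hi, mul_one]
  have hleft : ∀ M : Matrix (Fin m) (Fin m) 𝕜,
      (Uᴴ * (N * M) * U) j i = ((b ^ 2 : ℝ) : 𝕜) * (Uᴴ * M * U) j i := by
    intro M
    have : Uᴴ * (N * M) * U = Matrix.diagonal (fun i : Fin m => ((singVal A.1 i ^ 2 : ℝ) : 𝕜))
        * (Uᴴ * M * U) := by
      calc Uᴴ * (N * M) * U = (Uᴴ * U) * Matrix.diagonal
              (fun i : Fin m => ((singVal A.1 i ^ 2 : ℝ) : 𝕜)) * (Uᴴ * M * U) := by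
            rw [hmul]
            simp only [Matrix.mul_assoc]
        _ = _ := by rw [hU1, Matrix.one_mul]
    rw [this, Matrix.diagonal_mul]
  have hright : ∀ M : Matrix (Fin m) (Fin m) 𝕜,
      (Uᴴ * (M * N) * U) j i = (Uᴴ * M * U) j i * ((a ^ 2 : ℝ) : 𝕜) := by
    intro M
    have : Uᴴ * (M * N) * U = (Uᴴ * M * U)
        * Matrix.diagonal (fun i : Fin m => ((singVal A.1 i ^ 2 : ℝ) : 𝕜)) := by
      calc Uᴴ * (M * N) * U = (Uᴴ * M * U) * Matrix.diagonal
              (fun i : Fin m => ((singVal A.1 i ^ 2 : ℝ) : 𝕜)) * (Uᴴ * U) := by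
            rw [hmul]
            simp only [Matrix.mul_assoc]
        _ = _ := by rw [hU1, Matrix.mul_one]
    rw [this, Matrix.mul_diagonal]
  set E := N' - N with hE
  have hN1 : (1 - P) * N = N * (1 - P) := by
    rw [Matrix.sub_mul, Matrix.mul_sub, hN, Matrix.one_mul, Matrix.mul_one]
  -- the commutation relations turn the perturbation into a Sylvester equation for `(1 - P) * P'`
  have hsyl : (1 - P) * (E * P') = (1 - P) * P' * N + (1 - P) * P' * E - N * ((1 - P) * P') := by
    have e1 : (1 - P) * P' * N + (1 - P) * P' * E = (1 - P) * (P' * N') := by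
      rw [← Matrix.mul_add, hE, add_sub_cancel, Matrix.mul_assoc]
    rw [e1, hN', ← Matrix.mul_assoc N, ← hN1, hE, Matrix.sub_mul N', Matrix.mul_sub (1 - P),
      Matrix.mul_assoc (1 - P) N]
  have hent := congrArg (fun M => (Uᴴ * M * U) j i) hsyl
  simp only [Matrix.mul_sub Uᴴ, Matrix.mul_add Uᴴ, Matrix.sub_mul _ _ U, Matrix.add_mul _ _ U,
    Matrix.sub_apply, Matrix.add_apply] at hent
  rw [hleft, hright, hrow] at hent
  have hsplit : (Uᴴ * E * U) j i
      = (Uᴴ * (E * P') * U) j i + (Uᴴ * (E * ((1 - P') * P)) * U) j i := by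
    rw [← hcol (E * P'), ← Matrix.add_apply, ← Matrix.add_mul, ← Matrix.mul_add, ← hcol E,
      Matrix.mul_assoc E, ← Matrix.mul_add, ← Matrix.add_mul, add_sub_cancel, Matrix.one_mul]
  have hfin : (Uᴴ * E * U) j i = (Uᴴ * ((1 - P) * P') * U) j i * ((a ^ 2 - b ^ 2 : ℝ) : 𝕜)
      + (Uᴴ * ((1 - P) * P' * E) * U) j i + (Uᴴ * (E * ((1 - P') * P)) * U) j i := by
    rw [hsplit, hent]
    push_cast
    ring
  have b1 : ‖(Uᴴ * ((1 - P) * P') * U) j i * ((a ^ 2 - b ^ 2 : ℝ) : 𝕜)‖ ≤ c * |a ^ 2 - b ^ 2| := by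
    rw [norm_mul, RCLike.norm_ofReal, ← hW]
    exact mul_le_mul_of_nonneg_right (hle _) (abs_nonneg _)
  have b2 : ‖(Uᴴ * ((1 - P) * P' * E) * U) j i‖ ≤ c * ‖E‖ := by
    rw [← hW]
    exact (hle _).trans (Matrix.frobenius_norm_mul _ _)
  have b3 : ‖(Uᴴ * (E * ((1 - P') * P)) * U) j i‖ ≤ ‖E‖ * c := by
    rw [← hW']
    exact (hle _).trans (Matrix.frobenius_norm_mul _ _)
  rw [hfin]
  refine (norm_add₃_le).trans ?_
  linarith

/-- A direction `E` that realizes the condition number for the pair of positions `i ≠ j`. It is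
`E = X * A`, where `X` exchanges the left singular vectors at `i` and `j` and annihilates the
others. -/
theorem exists_perturbation (A : Matrix (Fin m) (Fin n) 𝕜) {U : Matrix (Fin m) (Fin m) 𝕜}
    {V : Matrix (Fin n) (Fin n) 𝕜} (h : IsFullSVD A U V) {i j : Fin m} (hij : i ≠ j) :
    ∃ (E : Matrix (Fin m) (Fin n) 𝕜) (C : ℝ), ‖E‖ = √(singVal A i ^ 2 + singVal A j ^ 2) ∧
      ∀ t : ℝ, 0 ≤ t → t ≤ 1 →
        ‖(A + t • E) * (A + t • E)ᴴ - A * Aᴴ‖ ≤ C * t ∧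
        t * (singVal A i ^ 2 + singVal A j ^ 2)
          ≤ ‖(Uᴴ * ((A + t • E) * (A + t • E)ᴴ - A * Aᴴ) * U) j i‖ := by
  have hU1 : Uᴴ * U = 1 := Matrix.mem_unitaryGroup_iff'.1 h.1
  have hmul := h.mul_col
  set a := singVal A i with ha
  set b := singVal A j with hb
  set D := Matrix.diagonal (fun i : Fin m => ((singVal A i ^ 2 : ℝ) : 𝕜)) with hD
  set S : Matrix (Fin m) (Fin m) 𝕜 := Matrix.single i j 1 + Matrix.single j i 1 with hS
  have hSt : Sᴴ = S := by
    rw [hS, Matrix.conjTranspose_add, Matrix.conjTranspose_single, Matrix.conjTranspose_single,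
      star_one, add_comm]
  set X := U * S * Uᴴ with hX
  have hXt : Xᴴ = X := by
    rw [hX, Matrix.conjTranspose_mul, Matrix.conjTranspose_mul, hSt,
      Matrix.conjTranspose_conjTranspose, Matrix.mul_assoc]
  have hexp : ∀ t : ℝ, (A + t • (X * A)) * (A + t • (X * A))ᴴ - A * Aᴴ
      = t • (X * (A * Aᴴ) + A * Aᴴ * X) + t ^ 2 • (X * (A * Aᴴ) * X) := by
    intro t
    rw [Matrix.conjTranspose_add, Matrix.conjTranspose_smul, Matrix.conjTranspose_mul, hXt,
      star_trivial, Matrix.add_mul, Matrix.mul_add, Matrix.mul_add]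
    simp only [Matrix.smul_mul, Matrix.mul_smul, smul_smul, smul_add, Matrix.mul_assoc, pow_two]
    abel
  refine ⟨X * A, ‖X * (A * Aᴴ) + A * Aᴴ * X‖ + ‖X * (A * Aᴴ) * X‖, ?_, fun t ht0 ht1 => ?_⟩
  · rw [hX, Matrix.mul_assoc, Matrix.mul_assoc, frobenius_norm_isometry_mul hU1,
      ← Real.sqrt_sq (norm_nonneg _)]
    congr 1
    apply RCLike.ofReal_injective (K := 𝕜)
    have hYY : Uᴴ * A * (Uᴴ * A)ᴴ = D := by
      calc Uᴴ * A * (Uᴴ * A)ᴴ = Uᴴ * (A * Aᴴ) * U := by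
            simp only [Matrix.conjTranspose_mul, Matrix.conjTranspose_conjTranspose,
              Matrix.mul_assoc]
        _ = Uᴴ * U * D * (Uᴴ * U) := by
            rw [hmul]
            simp only [Matrix.mul_assoc]
        _ = D := by rw [hU1, Matrix.one_mul, Matrix.mul_one]
    rw [frobenius_norm_sq_eq_trace, Matrix.trace_mul_comm, Matrix.conjTranspose_mul, hSt,
      Matrix.mul_assoc, ← Matrix.mul_assoc (Uᴴ * A), hYY, ← Matrix.mul_assoc]
    simp [hS, hD, Matrix.add_mul, Matrix.mul_add, Matrix.single_mul_mul_single, hij, hij.symm,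
      Matrix.trace_add, ← ha, ← hb]
  · rw [hexp]
    constructor
    · refine (norm_add_le _ _).trans ?_
      rw [norm_smul, norm_smul, Real.norm_of_nonneg ht0, Real.norm_of_nonneg (sq_nonneg t)]
      have : t ^ 2 ≤ t := by nlinarith
      have := mul_le_mul_of_nonneg_right this (norm_nonneg (X * (A * Aᴴ) * X))
      linarith
    · have e1 : Uᴴ * (t • (X * (A * Aᴴ) + A * Aᴴ * X) + t ^ 2 • (X * (A * Aᴴ) * X)) * U
          = t • (S * D + D * S) + t ^ 2 • (S * D * S) := by
        have key : ∀ Y Z : Matrix (Fin m) (Fin m) 𝕜,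
            U * Y * Uᴴ * (U * Z * Uᴴ) = U * (Y * Z) * Uᴴ := fun Y Z => by
          calc U * Y * Uᴴ * (U * Z * Uᴴ) = U * Y * (Uᴴ * U) * Z * Uᴴ := by
                simp only [Matrix.mul_assoc]
            _ = _ := by rw [hU1, Matrix.mul_one, Matrix.mul_assoc U]
        have key' : ∀ Y : Matrix (Fin m) (Fin m) 𝕜, Uᴴ * (U * Y * Uᴴ) * U = Y := fun Y => by
          calc Uᴴ * (U * Y * Uᴴ) * U = Uᴴ * U * Y * (Uᴴ * U) := by simp only [Matrix.mul_assoc]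
            _ = Y := by rw [hU1, Matrix.mul_one, Matrix.one_mul]
        rw [hmul, hX, key, key, key]
        simp only [Matrix.mul_add, Matrix.add_mul, Matrix.mul_smul, Matrix.smul_mul, key', smul_add]
      have e2 : (t • (S * D + D * S) + t ^ 2 • (S * D * S)) j i
          = ((t * (a ^ 2 + b ^ 2) : ℝ) : 𝕜) := by
        have hS1 : S j i = 1 := by simp [hS, hij]
        have hSDS : (S * D * S) j i = 0 := by
          simp [hS, hD, Matrix.add_mul, Matrix.mul_add, Matrix.single_mul_mul_single, hij, hij.symm]
        rw [Matrix.add_apply, Matrix.smul_apply, Matrix.smul_apply, hSDS, Matrix.add_apply,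
          hD, Matrix.mul_diagonal, Matrix.diagonal_mul, hS1, smul_zero, add_zero,
          RCLike.real_smul_eq_coe_mul]
        push_cast
        ring
      rw [e1, e2, RCLike.norm_ofReal]
      exact le_abs_self _

end LowerBound

/-! ### The gap ratio -/

section GapRatio

theorem gapRatio_nonneg (a b : ℝ) : 0 ≤ gapRatio a b := by
  unfold gapRatio
  positivity

theorem gapRatio_self (a : ℝ) : gapRatio a a = 0 := by simp [gapRatio]

theorem continuous_gapRatio : Continuous fun p : ℝ × ℝ => gapRatio p.1 p.2 := by
  refine continuous_iff_continuousAt.2 fun p => ?_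
  by_cases hp : p.1 ^ 2 + p.2 ^ 2 = 0
  · have h0 : gapRatio p.1 p.2 = 0 := by simp [gapRatio, hp]
    rw [ContinuousAt, h0]
    have hc : Continuous fun q : ℝ × ℝ => √(q.1 ^ 2 + q.2 ^ 2) := by fun_prop
    have hlim := hc.tendsto p
    simp only [hp, Real.sqrt_zero] at hlim
    refine squeeze_zero (fun q => gapRatio_nonneg _ _) (fun q => ?_) hlim
    refine div_le_of_le_mul₀ (Real.sqrt_nonneg _) (Real.sqrt_nonneg _) ?_
    rw [Real.mul_self_sqrt (by positivity), abs_le]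
    constructor <;> linarith [sq_nonneg q.1, sq_nonneg q.2]
  · unfold gapRatio
    refine ContinuousAt.div (by fun_prop) (by fun_prop) ?_
    rw [Real.sqrt_ne_zero (by positivity)]
    exact hp

theorem gapRatio_le (a b : ℝ) : gapRatio a b ≤ 2 * |a - b| := by
  refine div_le_of_le_mul₀ (Real.sqrt_nonneg _) (by positivity) ?_
  have h : |a + b| ≤ 2 * √(a ^ 2 + b ^ 2) := by
    refine abs_le_of_sq_le_sq ?_ (by positivity)
    rw [mul_pow, Real.sq_sqrt (by positivity)]
    nlinarith [sq_nonneg (a - b)]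
  calc |a ^ 2 - b ^ 2| = |a - b| * |a + b| := by
        rw [← abs_mul]
        congr 1
        ring
    _ ≤ |a - b| * (2 * √(a ^ 2 + b ^ 2)) := by gcongr
    _ = _ := by ring

end GapRatio

/-! ### The closed form of the condition number -/

section ConditionNumber

variable {𝕜 : Type*} [RCLike 𝕜] {m n : ℕ}

/-- The explicit value of the condition number: the largest reciprocal gap ratio over the pairs of a
position in `π` and a position outside. It is infinite if the two singular values of a pair
agree. -/
noncomputable def reciprocalGap (π : Finset (Fin m)) (A : Matrix (Fin m) (Fin n) 𝕜) : ℝ≥0∞ :=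
  (π ×ˢ πᶜ).sup fun p => (ENNReal.ofReal (gapRatio (singVal A p.1) (singVal A p.2)))⁻¹

theorem continuous_reciprocalGap (π : Finset (Fin m)) :
    Continuous (reciprocalGap π : Matrix (Fin m) (Fin n) 𝕜 → ℝ≥0∞) := by
  refine Continuous.finset_sup_apply fun p _ => ?_
  exact (ENNReal.continuous_ofReal.comp (continuous_gapRatio.comp
    ((continuous_singVal _).prodMk (continuous_singVal _)))).inv

/-- For small `z`, a bounded `c` with `c ≤ q₁ * z * (1 + c)` is so small that the factors `1 + c`
and `1 / √(1 - c ^ 2)` are absorbed by the passage from `q₁` to a larger constant `q₂`. -/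
theorem exists_pos_sqrt_bound (k : ℝ) {q₁ q₂ : ℝ} (hq₁ : 0 ≤ q₁) (hq : q₁ < q₂) :
    ∀ᶠ z in nhds (0 : ℝ), ∀ c, 0 ≤ c → c ≤ k → 0 ≤ z → c ≤ q₁ * z * (1 + c) →
      0 < √(1 - c ^ 2) ∧ q₁ * (1 + c) ≤ q₂ * √(1 - c ^ 2) := by
  have hcont : Continuous fun z : ℝ =>
      q₂ * √(1 - (q₁ * z * (1 + k)) ^ 2) - q₁ * (1 + q₁ * z * (1 + k)) := by fun_prop
  have h := hcont.tendsto 0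
  simp only [mul_zero, zero_mul, ne_eq, OfNat.ofNat_ne_zero, not_false_eq_true, zero_pow, sub_zero,
    Real.sqrt_one, mul_one, add_zero] at h
  filter_upwards [h.eventually (lt_mem_nhds (sub_pos.2 hq))] with z hz c hc0 hck hz0 hc
  have hc' : c ≤ q₁ * z * (1 + k) := hc.trans (by gcongr)
  have hq₂ : 0 < q₂ := hq₁.trans_lt hq
  have hmono : √(1 - (q₁ * z * (1 + k)) ^ 2) ≤ √(1 - c ^ 2) := by gcongr
  have h1 : q₁ * (1 + c) < q₂ * √(1 - c ^ 2) := by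
    calc q₁ * (1 + c) ≤ q₁ * (1 + q₁ * z * (1 + k)) := by gcongr
      _ < q₂ * √(1 - (q₁ * z * (1 + k)) ^ 2) := by linarith
      _ ≤ _ := by gcongr
  refine ⟨?_, h1.le⟩
  have h2 : 0 < q₂ * √(1 - c ^ 2) := lt_of_le_of_lt (by positivity) h1
  exact pos_of_mul_pos_right h2 hq₂.le

theorem leftCond_le_reciprocalGap (D : GrDistance) (π : Finset (Fin m)) (A : goodSet 𝕜 m n π) :
    leftCond D π A ≤ reciprocalGap π A.1 := by
  refine le_of_forall_gt_imp_ge_of_dense fun y hy => ?_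
  obtain ⟨q₁, hq₁, hq₁y⟩ := ENNReal.lt_iff_exists_nnreal_btwn.1 hy
  obtain ⟨q₂, hq₂, hq₂y⟩ := ENNReal.lt_iff_exists_nnreal_btwn.1 hq₁y
  have hq₁₂ : (q₁ : ℝ) < q₂ := by exact_mod_cast hq₂
  have hgap : ∀ᶠ B in nhds A.1, ∀ p ∈ π ×ˢ πᶜ,
      1 ≤ (q₁ : ℝ) * gapRatio (singVal B p.1) (singVal A.1 p.2) := by
    rw [Filter.eventually_all_finset]
    intro p hp
    have h1 : (ENNReal.ofReal (gapRatio (singVal A.1 p.1) (singVal A.1 p.2)))⁻¹ < q₁ :=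
      (Finset.le_sup (f := fun p : Fin m × Fin m =>
        (ENNReal.ofReal (gapRatio (singVal A.1 p.1) (singVal A.1 p.2)))⁻¹) hp).trans_lt hq₁
    have h2 : 1 < (q₁ : ℝ) * gapRatio (singVal A.1 p.1) (singVal A.1 p.2) := by
      have hpos : 0 < gapRatio (singVal A.1 p.1) (singVal A.1 p.2) := by
        by_contra h
        rw [ENNReal.ofReal_of_nonpos (not_lt.1 h), ENNReal.inv_zero] at h1
        exact not_top_lt h1
      rw [← ENNReal.ofReal_inv_of_pos hpos, ← ENNReal.ofReal_coe_nnreal,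
        ENNReal.ofReal_lt_ofReal_iff_of_nonneg (by positivity)] at h1
      rwa [inv_lt_iff_one_lt_mul₀ hpos] at h1
    have hc : Continuous fun B : Matrix (Fin m) (Fin n) 𝕜 =>
        (q₁ : ℝ) * gapRatio (singVal B p.1) (singVal A.1 p.2) :=
      continuous_const.mul (continuous_gapRatio.comp
        ((continuous_singVal _).prodMk continuous_const))
    exact ((hc.tendsto A.1).eventually (lt_mem_nhds h2)).mono fun _ h => h.le
  have hsmall := (tendsto_frobDist A.1).eventually
    (exists_pos_sqrt_bound ((π.card : ℝ) + 1) q₁.2 hq₁₂)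
  obtain ⟨ε, hε, H⟩ := exists_frobDist_ball (hgap.and hsmall)
  refine (iInf₂_le ε hε).trans (le_trans ?_ hq₂y.le)
  refine iSup_le fun A' => iSup_le fun _ => iSup_le fun hA' => ?_
  obtain ⟨hg, hs⟩ := H A'.1 hA'
  set c := grDist .chordal (leftMap π A) (leftMap π A') with hc
  have hc0 : 0 ≤ c := grDist_nonneg _ _ _
  -- a crude bound for `c`, which makes `c ≤ q₁ * z * (1 + c)` a Lipschitz estimate
  have hck : c ≤ (π.card : ℝ) + 1 := by
    have := sq_chordal_le (leftMap π A) (leftMap π A')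
    rw [← hc] at this
    nlinarith [sq_nonneg (c - 1)]
  have hup := chordal_le_of_gapRatio π A A' q₁.2 fun i hi j hj =>
    hg (i, j) (Finset.mk_mem_product hi (Finset.mem_compl.2 hj))
  rw [← hc, norm_sub_rev, ← frobDist_eq_norm] at hup
  have hz0 : 0 ≤ frobDist A.1 A'.1 := Real.sqrt_nonneg _
  obtain ⟨hroot, hbound⟩ := hs c hc0 hck hz0 hup
  have hd := (chordal_le_grDist_and_le D (leftMap π A) (leftMap π A')).2
  rw [← hc] at hd
  rw [← ENNReal.ofReal_coe_nnreal]
  refine ENNReal.ofReal_le_ofReal (div_le_of_le_mul₀ hz0 q₂.2 ?_)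
  refine le_of_mul_le_mul_left ?_ hroot
  calc √(1 - c ^ 2) * grDist D (leftMap π A) (leftMap π A')
      ≤ (q₁ * (1 + c)) * frobDist A.1 A'.1 :=
        hd.trans (hup.trans (le_of_eq (mul_right_comm _ _ _)))
    _ ≤ (q₂ * √(1 - c ^ 2)) * frobDist A.1 A'.1 := mul_le_mul_of_nonneg_right hbound hz0
    _ = _ := by ring

/-- Every pair of positions contributes: moving `A` in the direction of `exists_perturbation`
attains its reciprocal gap ratio in the limit. -/
theorem reciprocalGap_le_leftCond (D : GrDistance) (π : Finset (Fin m)) (A : goodSet 𝕜 m n π) :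
    reciprocalGap π A.1 ≤ leftCond D π A := by
  refine Finset.sup_le fun p hp => ?_
  obtain ⟨i, j⟩ := p
  obtain ⟨hi, hj⟩ := Finset.mem_product.1 hp
  replace hj : j ∉ π := Finset.mem_compl.1 hj
  have hne := mem_goodSet_iff.1 A.2 i hi j hj
  obtain ⟨U, V, h⟩ := exists_isFullSVD A.1
  obtain ⟨E, C, hE, hpert⟩ := exists_perturbation A.1 h (fun hij => hj (hij ▸ hi) : i ≠ j)
  have ha0 := singVal_nonneg A.1 i
  have hb0 := singVal_nonneg A.1 j
  simp only
  set a := singVal A.1 i with ha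
  set b := singVal A.1 j with hb
  set r := √(a ^ 2 + b ^ 2) with hr
  have hgap : 0 < |a ^ 2 - b ^ 2| := by
    rw [abs_pos, sub_ne_zero]
    exact fun hab => hne ((sq_eq_sq₀ ha0 hb0).1 hab)
  have hr2 : r ^ 2 = a ^ 2 + b ^ 2 := Real.sq_sqrt (by positivity)
  have hr0 : 0 < r := by
    refine Real.sqrt_pos.2 (lt_of_lt_of_le hgap ?_)
    rw [abs_le]
    constructor <;> linarith [sq_nonneg a, sq_nonneg b]
  rw [← ENNReal.ofReal_inv_of_pos (by unfold gapRatio; positivity), gapRatio, inv_div, ← hr]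
  refine le_iInf₂ fun ε hε => ?_
  -- along `A + t • E` the difference quotient is at least `r / (|a² - b²| + 2 C t)`
  have hlim : Filter.Tendsto (fun t : ℝ => ENNReal.ofReal (r / (|a ^ 2 - b ^ 2| + 2 * (C * t))))
      (nhdsWithin 0 (Set.Ioi 0)) (nhds (ENNReal.ofReal (r / |a ^ 2 - b ^ 2|))) := by
    refine (ENNReal.continuous_ofReal.tendsto _).comp ?_
    have hc : ContinuousAt (fun t : ℝ => r / (|a ^ 2 - b ^ 2| + 2 * (C * t))) 0 := by
      refine ContinuousAt.div (by fun_prop) (by fun_prop) ?_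
      simpa using hgap.ne'
    have := hc.tendsto.mono_left (nhdsWithin_le_nhds (s := Set.Ioi 0))
    simpa using this
  refine le_of_tendsto hlim ?_
  have hpath : Filter.Tendsto (fun t : ℝ => A.1 + t • E) (nhds 0) (nhds A.1) := by
    have hc : Continuous fun t : ℝ => A.1 + t • E := by fun_prop
    simpa using hc.tendsto 0
  have hgood := hpath.eventually ((isOpen_goodSet (𝕜 := 𝕜) (n := n) π).mem_nhds A.2)
  have hnear := ((tendsto_frobDist A.1).comp hpath).eventually (gt_mem_nhds hε)
  have hone : ∀ᶠ t : ℝ in nhds 0, t < 1 := gt_mem_nhds one_pos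
  filter_upwards [self_mem_nhdsWithin, nhdsWithin_le_nhds hgood, nhdsWithin_le_nhds hnear,
    nhdsWithin_le_nhds hone] with t (ht0 : 0 < t) ht hdist ht1
  obtain ⟨hC, hlow⟩ := hpert t ht0.le ht1.le
  have hz : frobDist A.1 (A.1 + t • E) = t * r := by
    rw [frobDist_eq_norm, sub_add_cancel_left, norm_neg, norm_smul, Real.norm_of_nonneg ht0.le, hE]
  have htr : 0 < t * r := by positivity
  let A' : goodSet 𝕜 m n π := ⟨A.1 + t • E, ht⟩
  have hA' : A' ≠ A := by
    intro heq
    have : A.1 + t • E = A.1 := congrArg Subtype.val heq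
    rw [this, frobDist_eq_norm, sub_self, norm_zero] at hz
    exact htr.ne hz
  refine le_trans ?_ (le_iSup₂_of_le A' hA' (le_iSup_of_le hdist.le le_rfl))
  refine ENNReal.ofReal_le_ofReal ?_
  change r / _ ≤ grDist D (leftMap π A) (leftMap π A') / frobDist A.1 (A.1 + t • E)
  rw [hz]
  have hlow2 := hlow.trans (norm_entry_le_chordal_mul A A' h hi hj)
  have hc := (chordal_le_grDist_and_le D (leftMap π A) (leftMap π A')).1
  have hCt : 0 ≤ C * t := (norm_nonneg _).trans hC
  rw [div_le_div_iff₀ (by positivity) htr]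
  calc r * (t * r) = t * (a ^ 2 + b ^ 2) := by
        rw [← hr2]
        ring
    _ ≤ _ := hlow2
    _ ≤ _ := by
        refine mul_le_mul hc ?_ (by positivity) (grDist_nonneg _ _ _)
        linarith

theorem leftCond_eq_reciprocalGap (D : GrDistance) (π : Finset (Fin m)) (A : goodSet 𝕜 m n π) :
    leftCond D π A = reciprocalGap π A.1 :=
  (leftCond_le_reciprocalGap D π A).antisymm (reciprocalGap_le_leftCond D π A)

theorem kappa_eq_reciprocalGap (D : GrDistance) (π : Finset (Fin m)) :
    (kappa D π : Matrix (Fin m) (Fin n) 𝕜 → ℝ≥0∞) = reciprocalGap π := by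
  funext A
  by_cases hA : A ∈ goodSet 𝕜 m n π
  · rw [kappa, dif_pos hA, leftCond_eq_reciprocalGap]
  · rw [kappa, dif_neg hA, eq_comm, ← top_le_iff]
    rw [mem_goodSet_iff] at hA
    push Not at hA
    obtain ⟨i, hi, j, hj, hij⟩ := hA
    refine le_trans ?_ (Finset.le_sup (Finset.mk_mem_product hi (Finset.mem_compl.2 hj)))
    simp only [hij, gapRatio_self, ENNReal.ofReal_zero, ENNReal.inv_zero, le_refl]

end ConditionNumber

end

/-! ### Continuity, divergence at the boundary, density -/

theorem mainTheorem6 (𝕜 : Type*) [RCLike 𝕜] (m n : ℕ) (π : Finset (Fin m)) (D : GrDistance) :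
    Continuous (kappa D π : Matrix (Fin m) (Fin n) 𝕜 → ℝ≥0∞) ∧
    (∀ M : ℝ≥0, ∃ δ : ℝ, 0 < δ ∧ ∀ A : goodSet 𝕜 m n π,
      (∃ B ∈ frontier (goodSet 𝕜 m n π), frobDist A.1 B < δ) → (M : ℝ≥0∞) < leftCond D π A) ∧
    ((∀ i j : Fin m, n ≤ (i : ℕ) → n ≤ (j : ℕ) → (i ∈ π ↔ j ∈ π)) →
      goodSet 𝕜 m n π ∪ frontier (goodSet 𝕜 m n π) = Set.univ) := by
  refine ⟨?_, fun M => ?_, fun hπ => ?_⟩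
  · rw [kappa_eq_reciprocalGap]
    exact continuous_reciprocalGap π
  · refine ⟨1 / (4 * (M + 1)), by positivity, ?_⟩
    rintro A ⟨B, hB, hAB⟩
    -- a boundary point has two equal singular values, which are close to those of `A`
    rw [(isOpen_goodSet π).frontier_eq] at hB
    have hB' := hB.2
    rw [mem_goodSet_iff] at hB'
    push Not at hB'
    obtain ⟨i, hi, j, hj, hij⟩ := hB'
    have h1 := abs_singVal_sub_le A.1 B i
    have h2 := abs_singVal_sub_le A.1 B j
    rw [← frobDist_eq_norm] at h1 h2
    have h3 : |singVal A.1 i - singVal A.1 j| < 2 * (1 / (4 * (M + 1))) := by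
      rw [hij] at h1
      rw [abs_le] at h1 h2
      rw [abs_lt]
      constructor <;> linarith
    have h4 : gapRatio (singVal A.1 i) (singVal A.1 j) < ((M : ℝ) + 1)⁻¹ := by
      refine (gapRatio_le _ _).trans_lt (lt_of_lt_of_le (mul_lt_mul_of_pos_left h3 two_pos) ?_)
      apply le_of_eq
      field_simp
      norm_num
    rw [leftCond_eq_reciprocalGap]
    refine lt_of_lt_of_le ?_ (Finset.le_sup (Finset.mk_mem_product hi (Finset.mem_compl.2 hj)))
    rw [ENNReal.lt_inv_iff_lt_inv]
    refine lt_of_lt_of_le ((ENNReal.ofReal_lt_ofReal_iff (by positivity)).2 h4) ?_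
    rw [ENNReal.ofReal_inv_of_pos (by positivity)]
    refine ENNReal.inv_le_inv.2 ?_
    rw [← ENNReal.ofReal_coe_nnreal]
    exact ENNReal.ofReal_le_ofReal (by linarith)
  · rw [← closure_eq_self_union_frontier, closure_goodSet hπ]
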